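/- **Setting.** Let $\mathsf F$ be any field. Costs count field operations ($+,-,\times,\div$) performed by straight-line programs over $\mathsf F$; the positions of the nonzero entries of the input matrices are known (sparse representation), and operations on indices are free. For a matrix $M$, $\#M$ is its number of nonzero entries. $f\in\tilde O(g)$ means $f\in O(g\log^{O(1)}g)$, that is, $f\le c\, g\,\log_2(g+2)^{k}$ with constants $c,k$. Let $2\le\omega\le 3$ be a feasible exponent of matrix multiplication, i.e. a routine is given that multiplies two $m\times m$ matrices over $\mathsf F$ with $O(m^\omega)$ operations. As is standard, assume also a given routine that multiplies two polynomials in $\mathsf F[x]$ of degree less than $d$ with $\tilde O(d)$ operations. **Algorithm** $\mathtt{DiffEval}(A,B,C,\theta,s)$, for $A\in\mathsf F^{r\times\ell}$, $B\in\mathsf F^{\ell\times n}$, $C\in\mathsf F^{r\times n}$, $\theta\in\mathsf F$ and an integer $s\ge 0$, with $V=(\theta^{ij})_{0\le i<n,\,0\le j<2s}\in\mathsf F^{n\times 2s}$: 1. compute $\theta^j$ by binary powering for all indices $j$ of nonzero columns of $B$ or $C$; 2. compute $Y_C=CV$ row by row: for a row with nonzero entries $u_j$ (in columns $j\in J$),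 its product with $V$ consists of the first $2s$ coefficients of the power series $\sum_{j\in J}u_j/(1-\theta^j x)$, computed with a product tree, Newton inversion of the denominator, and the given polynomial multiplication; 3. compute $Y_B=BV$ in the same way; 4. compute $Y_{AB}=AY_B$ by sparse multiplication (using only the nonzero entries of $A$, and computing in step 3 only the rows of $Y_B$ that are then used) or by dense multiplication (in square blocks of size $\min(r,\ell,2s)$, with the given matrix multiplication), whichever needs fewer operations in total; 5. return $Y_C-Y_{AB}$. **Lemma.** $\mathtt{DiffEval}$ always returns the correct matrix of evaluations $(C-AB)V\in\mathsf F^{r\times 2s}$. If $\ell\ge 1$, it uses $$\tilde O\!\left(\#B+\#C+n+s\cdot\min\!\left(\#A+r,\ \frac{r\ell}{\min(r,s,\ell)^{3-\omega}}\right)\right)$$ field operations, where the term $s\cdot\min(\cdots)$ is read as $0$ if $r=0$ or $s=0$. The constants hidden in $\tilde O$ depend only on $\omega$ and on the constants in the cost bounds of the two given routines; they do not depend on $\mathsf F$, on $r,\ell,n,s$, or on the matrices and $\theta$. -/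

import Mathlib

/-! # Straight-line programs over a field -/

namespace MatEC

universe u

/-- The four field operations. -/
inductive FieldOp where
  | add | sub | mul | div

/-- Value of a field operation; a division by zero returns `0`. -/
def FieldOp.apply {F : Type u} [Field F] : FieldOp → F → F → F
  | .add, x, y => x + y
  | .sub, x, y => x - y
  | .mul, x, y => x * y
  | .div, x, y => x / y

/-- An operand: an input variable, a constant of `F`, or the result of the `k`-th instruction. -/
inductive Ref (F : Type u) (ι : Type) where
  | inp (i : ι)
  | const (c : F)
  | reg (k : ℕ)

/-- One instruction performs one field operation on two operands. -/
structure Instr (F : Type u) (ι : Type) where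
  op : FieldOp
  lhs : Ref F ι
  rhs : Ref F ι

/-- A straight-line program with input variables `ι` and outputs `κ`. The result of the `k`-th
instruction of `code` is stored in register `k`. -/
structure SLP (F : Type u) (ι κ : Type) where
  code : List (Instr F ι)
  out : κ → Ref F ι

section Semantics

variable {F : Type u} {ι κ : Type}

/-- The operand refers to one of the first `k` registers, if to a register at all. -/
def Ref.Below (k : ℕ) : Ref F ι → Prop
  | .inp _ => True
  | .const _ => True
  | .reg j => j < k

/-- Every instruction uses only registers that were written before it, and every output is
available at the end. -/
def SLP.WellFormed (P : SLP F ι κ) : Prop :=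
  (∀ (k : ℕ) (h : k < P.code.length), (P.code[k]).lhs.Below k ∧ (P.code[k]).rhs.Below k) ∧
    ∀ o : κ, (P.out o).Below P.code.length

/-- The number of field operations performed by the program. -/
def SLP.cost (P : SLP F ι κ) : ℕ := P.code.length

variable [Field F]

def Ref.val (x : ι → F) (mem : List F) : Ref F ι → F
  | .inp i => x i
  | .const c => c
  | .reg k => mem.getD k 0

/-- Execute the instructions one after the other, appending each result to the memory. -/
def runCode (x : ι → F) (code : List (Instr F ι)) : List F :=
  code.foldl (fun mem I => mem ++ [I.op.apply (I.lhs.val x mem) (I.rhs.val x mem)]) []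

/-- The outputs of the program on the input `x`. -/
def SLP.eval (P : SLP F ι κ) (x : ι → F) (o : κ) : F :=
  (P.out o).val x (runCode x P.code)

end Semantics

/-! # The two subroutines, and soft-oh bounds -/

/-- The bound `c * g * (log₂ (g + 2)) ^ k` behind "`f` is softly `O` of `g`". -/
noncomputable def softBound (c : ℝ) (k : ℕ) (g : ℝ) : ℝ :=
  c * g * Real.logb 2 (g + 2) ^ k

/-- `mm m` multiplies two `m × m` matrices (left factor `Sum.inl`, right factor `Sum.inr`),
with at most `c * m ^ ω` field operations for all `m`. So such a family exists for some `c` if and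
only if `ω` is a feasible exponent of matrix multiplication over `F`. -/
def IsMatMulFamily {F : Type u} [Field F] (ω c : ℝ)
    (mm : ∀ m : ℕ, SLP F ((Fin m × Fin m) ⊕ (Fin m × Fin m)) (Fin m × Fin m)) : Prop :=
  ∀ m : ℕ, (mm m).WellFormed ∧
    (∀ X Y : Matrix (Fin m) (Fin m) F, ∀ i j : Fin m,
      (mm m).eval (Sum.elim (fun p => X p.1 p.2) (fun p => Y p.1 p.2)) (i, j) = (X * Y) i j) ∧
    ((mm m).cost : ℝ) ≤ c * (m : ℝ) ^ ω

/-- The polynomial of degree less than `d` with the coefficients `a`. -/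
noncomputable def polyOfCoeffs {F : Type u} [Field F] {d : ℕ} (a : Fin d → F) : Polynomial F :=
  ∑ i : Fin d, Polynomial.monomial (i : ℕ) (a i)

/-- `pm d` multiplies two polynomials of degree less than `d`, given and returned as lists of
coefficients, with a number of field operations that is softly linear in `d`. -/
def IsPolyMulFamily {F : Type u} [Field F] (c : ℝ) (k : ℕ)
    (pm : ∀ d : ℕ, SLP F (Fin d ⊕ Fin d) (Fin (2 * d - 1))) : Prop :=
  ∀ d : ℕ, (pm d).WellFormed ∧
    (∀ a b : Fin d → F, ∀ t : Fin (2 * d - 1),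
      (pm d).eval (Sum.elim a b) t = (polyOfCoeffs a * polyOfCoeffs b).coeff (t : ℕ)) ∧
    ((pm d).cost : ℝ) ≤ softBound c k (d : ℝ)

/-! # Writing programs: a monad that appends instructions -/

/-- A procedure that appends instructions to the program written so far and returns (operands
holding) results. -/
abbrev Build (F : Type u) (ι : Type) (α : Type u) : Type u := StateM (List (Instr F ι)) α

section Build

variable {F : Type u} {ι : Type}

/-- Perform one field operation. -/
def emit (o : FieldOp) (a b : Ref F ι) : Build F ι (Ref F ι) :=
  modifyGet fun code => (Ref.reg code.length, code ++ [⟨o, a, b⟩])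

/-- Translate an operand of a subroutine whose inputs are `args` and whose first register
is `off`. -/
def Ref.relocate {ι' : Type} (args : ι' → Ref F ι) (off : ℕ) : Ref F ι' → Ref F ι
  | .inp i => args i
  | .const c => .const c
  | .reg k => .reg (off + k)

/-- Run the subroutine `P` on the operands `args`. -/
def call {ι' κ : Type} (P : SLP F ι' κ) (args : ι' → Ref F ι) : Build F ι (κ → Ref F ι) :=
  modifyGet fun code =>
    (fun o => (P.out o).relocate args code.length,
      code ++ P.code.map fun I =>
        ⟨I.op, I.lhs.relocate args code.length, I.rhs.relocate args code.length⟩)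

/-- The complete program written by a procedure. -/
def Build.toSLP {κ : Type} (b : Build F ι (κ → Ref F ι)) : SLP F ι κ :=
  let res := b.run []
  ⟨res.2, res.1⟩

variable [Field F]

/-- `x ^ e` by binary powering. -/
def powRef (x : Ref F ι) (e : ℕ) : Build F ι (Ref F ι) :=
  if e = 0 then pure (.const 1)
  else if e = 1 then pure x
  else do
    let y ← powRef x (e / 2)
    let y2 ← emit .mul y y
    if e % 2 = 1 then emit .mul y2 x else pure y2
termination_by e
decreasing_by omega

/-! ## Polynomials, as lists of coefficients starting with the constant one -/

/-- The coefficient of `x ^ i`. -/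
def coeffRef (a : List (Ref F ι)) (i : ℕ) : Ref F ι := a.getD i (.const 0)

/-- Coefficientwise operation on two polynomials. -/
def polyZip (o : FieldOp) (a b : List (Ref F ι)) : Build F ι (List (Ref F ι)) :=
  (List.range (max a.length b.length)).mapM fun i => emit o (coeffRef a i) (coeffRef b i)

/-- Product of two polynomials by the given multiplication routine. -/
def polyMul (pm : ∀ d : ℕ, SLP F (Fin d ⊕ Fin d) (Fin (2 * d - 1)))
    (a b : List (Ref F ι)) : Build F ι (List (Ref F ι)) := do
  let res ← call (pm (max a.length b.length))
    (Sum.elim (fun i => coeffRef a i) (fun i => coeffRef b i))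
  return (List.ofFn res).take (a.length + b.length - 1)

/-- Numerator and denominator of `∑ u / (1 - v x)` over the pairs `(u, v)` of a list, by divide and
conquer along a product tree. -/
def sumFractions (pm : ∀ d : ℕ, SLP F (Fin d ⊕ Fin d) (Fin (2 * d - 1)))
    (l : List (Ref F ι × Ref F ι)) : Build F ι (List (Ref F ι) × List (Ref F ι)) :=
  match l with
  | [] => pure ([], [.const 1])
  | [(u, v)] => do
    let w ← emit .sub (.const 0) v
    return ([u], [.const 1, w])
  | x :: y :: l => do
    let (p₁, q₁) ← sumFractions pm ((x :: y :: l).take ((l.length + 2) / 2))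
    let (p₂, q₂) ← sumFractions pm ((x :: y :: l).drop ((l.length + 2) / 2))
    let a ← polyMul pm p₁ q₂
    let b ← polyMul pm p₂ q₁
    let p ← polyZip .add a b
    let q ← polyMul pm q₁ q₂
    return (p, q)
termination_by l.length
decreasing_by all_goals (simp only [List.length_take, List.length_drop, List.length_cons]; omega)

/-- The inverse modulo `x ^ (2 ^ t)` of a polynomial `q` with constant coefficient `1`, by Newton
iteration `g ↦ g + g (1 - q g)`. -/
def invSeries (pm : ∀ d : ℕ, SLP F (Fin d ⊕ Fin d) (Fin (2 * d - 1)))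
    (q : List (Ref F ι)) : ℕ → Build F ι (List (Ref F ι))
  | 0 => pure [.const 1]
  | t + 1 => do
    let g ← invSeries pm q t
    let h ← polyMul pm (q.take (2 ^ (t + 1))) g
    let e ← polyZip .sub [.const 1] (h.take (2 ^ (t + 1)))
    let ge ← polyMul pm g e
    polyZip .add g (ge.take (2 ^ (t + 1)))

/-- Transposed Vandermonde application: from a list of pairs `(u, v)`, the sums `∑ u * v ^ j` for
`0 ≤ j < N`, as the first `N` coefficients of the power series `∑ u / (1 - v x)`. -/
def transposedVandermonde (pm : ∀ d : ℕ, SLP F (Fin d ⊕ Fin d) (Fin (2 * d - 1)))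
    (N : ℕ) (l : List (Ref F ι × Ref F ι)) : Build F ι (List (Ref F ι)) := do
  let (p, q) ← sumFractions pm l
  let g ← invSeries pm q (Nat.clog 2 N)
  let y ← polyMul pm (p.take N) (g.take N)
  return y.take N

/-! ## Matrices, as functions that return the operand `0` outside the index range -/

/-- Product of the `r × ℓ` matrix `X`, whose nonzero entries in row `i` are in the columns
`cols i`, and a matrix `Y` with `N` columns, by the definition of the product restricted to these
entries. -/
def sparseMul (r N : ℕ) (cols : ℕ → List ℕ) (X Y : ℕ → ℕ → Ref F ι) :
    Build F ι (ℕ → ℕ → Ref F ι) := do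
  let Z ← (List.range r).mapM fun i => (List.range N).mapM fun j =>
    (cols i).foldlM (fun acc k => do
      let z ← emit .mul (X i k) (Y k j)
      emit .add acc z) (.const 0)
  return fun i j => (Z.getD i []).getD j (.const 0)

/-- Product of an `r × ℓ` and an `ℓ × N` matrix by blocks of size `m × m` with
`m = min(r, ℓ, N)` (and `m = 1` if this is `0`), where products of blocks are computed by the
given routine. -/
def denseMul (mm : ∀ m : ℕ, SLP F ((Fin m × Fin m) ⊕ (Fin m × Fin m)) (Fin m × Fin m))
    (r ℓ N : ℕ) (X Y : ℕ → ℕ → Ref F ι) : Build F ι (ℕ → ℕ → Ref F ι) := do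
  let m := max 1 (min r (min ℓ N))
  let Z ← (List.range (r ⌈/⌉ m)).mapM fun I => (List.range (N ⌈/⌉ m)).mapM fun J =>
    (List.range (ℓ ⌈/⌉ m)).foldlM (fun (acc : List (List (Ref F ι))) K => do
      let p ← call (mm m) (Sum.elim
        (fun a => X (I * m + a.1) (K * m + a.2)) (fun a => Y (K * m + a.1) (J * m + a.2)))
      (List.finRange m).mapM fun (a : Fin m) => (List.finRange m).mapM fun (b : Fin m) =>
        emit .add (coeffRef (acc.getD (a : ℕ) []) (b : ℕ)) (p (a, b))) []
  return fun i j => coeffRef ((((Z.getD (i / m) []).getD (j / m) [])).getD (i % m) []) (j % m)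

end Build

/-! # The algorithm DiffEval -/

/-- The inputs of the algorithm: the entries of `A`, `B`, `C`, and the element `θ`. -/
inductive DiffEvalInput (r ℓ n : ℕ) where
  | a (i : Fin r) (k : Fin ℓ)
  | b (k : Fin ℓ) (j : Fin n)
  | c (i : Fin r) (j : Fin n)
  | theta

/-- The two ways to multiply `A` by `B V`. -/
inductive MulMode where
  | sparse | dense
deriving DecidableEq

section DiffEval

variable {F : Type u} [Field F]

/-- The matrix with the operands `e i j` at the positions `(i, j)` in `S`, and `0` elsewhere. -/
def sparseRef {ι : Type} {p q : ℕ} (S : Finset (Fin p × Fin q)) (e : Fin p → Fin q → ι) (i j : ℕ) :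
    Ref F ι :=
  if h : i < p ∧ j < q then
    if (⟨i, h.1⟩, ⟨j, h.2⟩) ∈ S then .inp (e ⟨i, h.1⟩ ⟨j, h.2⟩) else .const 0
  else .const 0

/-- The columns of the positions of `S` in row `i`. -/
def rowCols {p q : ℕ} (S : Finset (Fin p × Fin q)) (i : ℕ) : List ℕ :=
  (List.range q).filter fun j => decide (∃ x ∈ S, (x.1 : ℕ) = i ∧ (x.2 : ℕ) = j)

/-- The algorithm, with the given way to multiply `A` by `B V`, for matrices whose nonzero entries
are at the positions `SA`, `SB`, `SC`. With sparse multiplication, only those rows of `B V` are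
computed that are multiplied by a nonzero entry of `A`. -/
def diffEvalBuild (pm : ∀ d : ℕ, SLP F (Fin d ⊕ Fin d) (Fin (2 * d - 1)))
    (mm : ∀ m : ℕ, SLP F ((Fin m × Fin m) ⊕ (Fin m × Fin m)) (Fin m × Fin m))
    (mode : MulMode) {r ℓ n : ℕ} (s : ℕ) (SA : Finset (Fin r × Fin ℓ))
    (SB : Finset (Fin ℓ × Fin n)) (SC : Finset (Fin r × Fin n)) :
    Build F (DiffEvalInput r ℓ n) (Fin r × Fin (2 * s) → Ref F (DiffEvalInput r ℓ n)) := do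
  -- powers of `θ` for the indices of nonzero columns of `B` or `C`
  let pows ← (List.range n).mapM fun j =>
    if (∃ x ∈ SB, (x.2 : ℕ) = j) ∨ (∃ x ∈ SC, (x.2 : ℕ) = j)
    then powRef (.inp .theta) j else pure (.const 0)
  let matA := sparseRef SA .a
  let matB := sparseRef SB .b
  let matC := sparseRef SC .c
  -- `C V`, row by row
  let YC ← (List.range r).mapM fun i =>
    transposedVandermonde pm (2 * s)
      ((rowCols SC i).map fun j => (matC i j, pows.getD j (.const 0)))
  -- `B V`, row by row
  let YB ← (List.range ℓ).mapM fun k =>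
    if mode = .dense ∨ (∃ x ∈ SA, (x.2 : ℕ) = k) then
      transposedVandermonde pm (2 * s)
        ((rowCols SB k).map fun j => (matB k j, pows.getD j (.const 0)))
    else pure []
  let matYB := fun k j => coeffRef (YB.getD k []) j
  -- `A (B V)`
  let YAB ← match mode with
    | .sparse => sparseMul r (2 * s) (rowCols SA) matA matYB
    | .dense => denseMul mm r ℓ (2 * s) matA matYB
  -- `C V - A (B V)`
  let Y ← (List.range r).mapM fun i => (List.range (2 * s)).mapM fun j =>
    emit .sub (coeffRef (YC.getD i []) j) (YAB i j)
  return fun o => coeffRef (Y.getD o.1 []) o.2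

/-- The algorithm DiffEval, using dense or sparse multiplication, whichever is faster. -/
def diffEval (pm : ∀ d : ℕ, SLP F (Fin d ⊕ Fin d) (Fin (2 * d - 1)))
    (mm : ∀ m : ℕ, SLP F ((Fin m × Fin m) ⊕ (Fin m × Fin m)) (Fin m × Fin m))
    {r ℓ n : ℕ} (s : ℕ) (SA : Finset (Fin r × Fin ℓ))
    (SB : Finset (Fin ℓ × Fin n)) (SC : Finset (Fin r × Fin n)) :
    SLP F (DiffEvalInput r ℓ n) (Fin r × Fin (2 * s)) :=
  let sp := (diffEvalBuild pm mm .sparse s SA SB SC).toSLP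
  let de := (diffEvalBuild pm mm .dense s SA SB SC).toSLP
  if sp.cost ≤ de.cost then sp else de

/-- The values of the inputs of the algorithm. -/
def diffEvalInput {r ℓ n : ℕ} (A : Matrix (Fin r) (Fin ℓ) F) (B : Matrix (Fin ℓ) (Fin n) F)
    (C : Matrix (Fin r) (Fin n) F) (θ : F) : DiffEvalInput r ℓ n → F
  | .a i k => A i k
  | .b k j => B k j
  | .c i j => C i j
  | .theta => θ

/-- The positions of the nonzero entries of a matrix. -/
def nonzeros [DecidableEq F] {p q : ℕ} (M : Matrix (Fin p) (Fin q) F) : Finset (Fin p × Fin q) :=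
  Finset.univ.filter fun x => M x.1 x.2 ≠ 0

/-- The `n × 2s` evaluation matrix `(θ ^ (i j))`. -/
def evalMatrix (θ : F) (n s : ℕ) : Matrix (Fin n) (Fin (2 * s)) F :=
  Matrix.of fun i j => θ ^ ((i : ℕ) * (j : ℕ))

end DiffEval

end MatEC

/-! The program is analysed by a Hoare logic for procedures that write instructions. The triple
`Spec code b cost post` says that `b`, started after the well-formed program `code`, appends at most
`cost` instructions, keeps the program well-formed, and returns operands that satisfy `post`. All
assertions are built from `Computes x code a v` (the operand `a` has the value `v`), which is
preserved when the program grows; so well-formedness, correctness and cost come out of one pass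
through the code.

*Correctness.* A row with entries `u_j` times the evaluation matrix consists of the first `2s`
coefficients of `∑ u_j / (1 - θ^j x)`. Polynomials are interpreted as power series, the product tree
computes a numerator `P` and a denominator `Q` with constant coefficient `1` such that
`P = Q * ∑ u_j / (1 - θ^j x)` (`spec_sumFractions`), Newton iteration inverts `Q` modulo a power of
`x` that is at least the `2s`-th (`spec_invSeries`), and truncations are congruences modulo powers
of `x`. The rows of `B V` that sparse multiplication leaves out are only ever multiplied by zero
entries of `A` (`spec_diffEvalBuild`).

*Cost.* All polynomials that are multiplied have length at most `D = max(n, 4s)`. For these lengths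
the given multiplication costs at most `Λ` operations per coefficient, where `Λ` is polylogarithmic
in `D`, and a product tree has at most `h = ⌊log₂ n⌋ + 1` levels. With `Λ` and `h` fixed, every
soft-oh bound becomes linear: a row with `t` nonzero entries costs at most `K (t + 2s)` with
`K = (9 Λ + 8) (h + 1)` (`spec_transposedVandermonde`), and such costs can be summed over the rows.
This gives `O(K (#B + #C + n + s (#A + r)))` for sparse multiplication (`diffEvalCost_sparse_le`).
For dense multiplication there are the rows of `B V`, which cost `O(K (#B + s ℓ))`, those of `C V`,
which cost `O(K (#C + s r))`, and `O(r s ℓ / m ^ 3)` block products for blocks of size `m`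
(`mulCost_dense_le`). Both `r` and `ℓ` are at most `r ℓ / min(r, s, ℓ) ^ (3 - ω)`
(`max_le_mul_div_rpow`). Finally `D ≤ 4 g` for the size `g` in the bound if `1 ≤ r`, so that `K` is
polylogarithmic in `g` (`rowFactor_le`); for `r = 0` sparse multiplication computes nothing but
powers of `θ`. -/

namespace MatEC

universe u

/-! ### A Hoare logic for programs that write programs -/

section Logic

variable {F : Type u} {ι κ : Type}

/-- Every instruction uses only registers that were written before it. -/
def CodeOk (code : List (Instr F ι)) : Prop :=
  ∀ (k : ℕ) (h : k < code.length), (code[k]).lhs.Below k ∧ (code[k]).rhs.Below k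

theorem codeOk_nil : CodeOk ([] : List (Instr F ι)) := fun _ h => absurd h (Nat.not_lt_zero _)

theorem codeOk_concat {code : List (Instr F ι)} {I : Instr F ι} :
    CodeOk (code ++ [I]) ↔
      CodeOk code ∧ I.lhs.Below code.length ∧ I.rhs.Below code.length := by
  constructor
  · intro h
    refine ⟨fun k hk => ?_, ?_⟩
    · have := h k (by simp; omega)
      rwa [List.getElem_append_left hk] at this
    · have := h code.length (by simp)
      simpa using this
  · rintro ⟨h1, h2⟩ k hk
    rcases Nat.lt_or_ge k code.length with hk' | hk'
    · rw [List.getElem_append_left hk']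
      exact h1 k hk'
    · obtain rfl : k = code.length := by simp at hk; omega
      simpa using h2

theorem Ref.Below.mono {k k' : ℕ} (h : k ≤ k') {a : Ref F ι} (ha : a.Below k) : a.Below k' := by
  cases a with
  | inp i => trivial
  | const c => trivial
  | reg j => exact lt_of_lt_of_le (show j < k from ha) h

/-- Hoare triple for a procedure started after the well-formed program `code`: it appends at most
`cost` instructions, keeps the program well-formed, and `post` holds for the extended program and
the returned value. -/
def Spec {α : Type u} (code : List (Instr F ι)) (b : Build F ι α) (cost : ℕ)
    (post : List (Instr F ι) → α → Prop) : Prop :=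
  CodeOk code → code <+: (b.run code).2 ∧ (b.run code).2.length ≤ code.length + cost ∧
    CodeOk (b.run code).2 ∧ post (b.run code).2 (b.run code).1

theorem Spec.pure {α : Type u} {code : List (Instr F ι)} {a : α}
    {post : List (Instr F ι) → α → Prop} (h : post code a) :
    Spec code (pure a : Build F ι α) 0 post :=
  fun hc => ⟨List.prefix_refl _, le_rfl, hc, h⟩

theorem Spec.bind {α β : Type u} {code : List (Instr F ι)} {b : Build F ι α}
    {f : α → Build F ι β} {c₁ c₂ : ℕ} {mid : List (Instr F ι) → α → Prop}
    {post : List (Instr F ι) → β → Prop} (h₁ : Spec code b c₁ mid)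
    (h₂ : ∀ code' a, code <+: code' → mid code' a → Spec code' (f a) c₂ post) :
    Spec code (b >>= f) (c₁ + c₂) post := by
  intro hc
  obtain ⟨p1, l1, o1, m1⟩ := h₁ hc
  obtain ⟨p2, l2, o2, m2⟩ := h₂ _ _ p1 m1 o1
  exact ⟨p1.trans p2, l2.trans (by omega), o2, m2⟩

theorem Spec.mono {α : Type u} {code : List (Instr F ι)} {b : Build F ι α} {c c' : ℕ}
    {post post' : List (Instr F ι) → α → Prop} (h : Spec code b c post) (hc : c ≤ c')
    (hp : ∀ code' a, code <+: code' → post code' a → post' code' a) : Spec code b c' post' := by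
  intro ho
  obtain ⟨p1, l1, o1, m1⟩ := h ho
  exact ⟨p1, l1.trans (by omega), o1, hp _ _ p1 m1⟩

theorem Spec.mapM {α : Type} {β : Type u} {f : α → Build F ι β} {c : α → ℕ}
    {R : α → List (Instr F ι) → β → Prop}
    (hR : ∀ a b code code', code <+: code' → R a code b → R a code' b) (l : List α) :
    ∀ {code : List (Instr F ι)},
      (∀ a ∈ l, ∀ code', code <+: code' → Spec code' (f a) (c a) (R a)) →
      Spec code (l.mapM f) (l.map c).sum
        fun code' out => List.Forall₂ (fun a b => R a code' b) l out := by
  induction l with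
  | nil => intro code _; exact Spec.pure List.Forall₂.nil
  | cons a l ih =>
    intro code h
    rw [List.mapM_cons, List.map_cons, List.sum_cons]
    refine (h a (by simp) _ (List.prefix_refl _)).bind fun code₁ b h₁ hb => ?_
    refine ((ih fun a' ha' code' h' => h a' (by simp [ha']) _ (h₁.trans h')).bind
      fun code₂ bs h₂ hbs => Spec.pure ?_ : Spec _ _ (_ + 0) _)
    exact .cons (hR _ _ _ _ h₂ hb) hbs

theorem Spec.mapM_range {β : Type u} {n : ℕ} {f : ℕ → Build F ι β} {c : ℕ → ℕ}
    {R : ℕ → List (Instr F ι) → β → Prop} {code : List (Instr F ι)}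
    (hR : ∀ a b code code', code <+: code' → R a code b → R a code' b)
    (h : ∀ i < n, ∀ code', code <+: code' → Spec code' (f i) (c i) (R i)) :
    Spec code ((List.range n).mapM f) (∑ i ∈ Finset.range n, c i)
      fun code' out => out.length = n ∧ ∀ i < n, ∀ d, R i code' (out.getD i d) := by
  refine (Spec.mapM hR (List.range n) (c := c) fun a ha => h a (List.mem_range.1 ha)).mono ?_ ?_
  · rw [← List.sum_toFinset _ List.nodup_range, List.toFinset_range]
  · intro code' out _ hout
    have hl := hout.length_eq
    simp only [List.length_range] at hl
    refine ⟨hl.symm, fun i hi d => ?_⟩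
    have := hout.get (i := i) (by simpa) (by omega)
    rw [List.getD_eq_getElem _ _ (by omega)]
    simpa using this

theorem Spec.mapM_finRange {β : Type u} {n : ℕ} {f : Fin n → Build F ι β} {c : ℕ}
    {R : Fin n → List (Instr F ι) → β → Prop} {code : List (Instr F ι)}
    (hR : ∀ a b code code', code <+: code' → R a code b → R a code' b)
    (h : ∀ i, ∀ code', code <+: code' → Spec code' (f i) c (R i)) :
    Spec code ((List.finRange n).mapM f) (n * c)
      fun code' out => ∀ (i : Fin n) (d : β), R i code' (out.getD i d) := by
  refine (Spec.mapM hR (List.finRange n) (c := fun _ => c) fun a _ => h a).mono ?_ ?_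
  · simp
  · intro code' out _ hout i d
    have hl := hout.length_eq
    simp only [List.length_finRange] at hl
    have hi := i.2
    have := hout.get (i := i) (by simp) (by omega)
    rw [List.getD_eq_getElem _ _ (by omega)]
    simpa using this

/-- Loop rule: `Rep code a v` says that the accumulator `a` represents the value `v`, and each pass
through the loop acts as `step` on the represented values. -/
theorem Spec.foldlM {α V : Type*} {β : Type u} {f : β → α → Build F ι β} {c : ℕ}
    {Rep : List (Instr F ι) → β → V → Prop} {step : V → α → V} (l : List α) :
    ∀ {code : List (Instr F ι)} {init : β} {v : V},
      (∀ a ∈ l, ∀ code' b w, code <+: code' → Rep code' b w →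
        Spec code' (f b a) c fun code'' b' => Rep code'' b' (step w a)) →
      Rep code init v →
      Spec code (l.foldlM f init) (l.length * c) fun code' b => Rep code' b (l.foldl step v) := by
  induction l with
  | nil => intro code init v _ h; exact (Spec.pure h).mono (by simp) fun _ _ _ h => h
  | cons a l ih =>
    intro code init v h hi
    rw [List.foldlM_cons]
    refine ((h a (by simp) _ _ _ (List.prefix_refl _) hi).bind fun code₁ b h₁ hb =>
      ih (fun a' ha' code' b' w h' => h a' (by simp [ha']) _ _ _ (h₁.trans h')) hb).mono ?_
      fun _ _ _ h => h
    rw [List.length_cons]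
    exact le_of_eq (by ring)

end Logic

/-! ### Values of operands -/

section Values

variable {F : Type u} [Field F] {ι κ : Type}

theorem runCode_concat (x : ι → F) (code : List (Instr F ι)) (I : Instr F ι) :
    runCode x (code ++ [I]) = runCode x code ++
      [I.op.apply (I.lhs.val x (runCode x code)) (I.rhs.val x (runCode x code))] := by
  simp [runCode, List.foldl_append]

theorem length_runCode (x : ι → F) (code : List (Instr F ι)) :
    (runCode x code).length = code.length := by
  induction code using List.reverseRecOn with
  | nil => rfl
  | append_singleton l a ih => simp [runCode_concat, ih]

theorem runCode_prefix (x : ι → F) {code code' : List (Instr F ι)} (h : code <+: code') :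
    runCode x code <+: runCode x code' := by
  obtain ⟨d, rfl⟩ := h
  induction d using List.reverseRecOn with
  | nil => simp
  | append_singleton l a ih =>
    rw [← List.append_assoc, runCode_concat]
    exact ih.trans (List.prefix_append _ _)

/-- After the program `code` has been run on the input `x`, the operand `a` is available and has the
value `v`. -/
def Computes (x : ι → F) (code : List (Instr F ι)) (a : Ref F ι) (v : F) : Prop :=
  a.Below code.length ∧ a.val x (runCode x code) = v

theorem Ref.val_of_prefix (x : ι → F) {mem mem' : List F} (h : mem <+: mem') {a : Ref F ι}
    (ha : a.Below mem.length) : a.val x mem' = a.val x mem := by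
  cases a with
  | inp i => rfl
  | const c => rfl
  | reg j =>
    have hj : j < mem.length := ha
    have := h.length_le
    simp only [Ref.val]
    rw [List.getD_eq_getElem _ _ hj, List.getD_eq_getElem _ _ (by omega)]
    exact (h.getElem hj).symm

theorem Computes.mono {x : ι → F} {code code' : List (Instr F ι)} (h : code <+: code')
    {a : Ref F ι} {v : F} (ha : Computes x code a v) : Computes x code' a v :=
  ⟨ha.1.mono h.length_le, by
    rw [Ref.val_of_prefix x (runCode_prefix x h) (by rw [length_runCode]; exact ha.1), ha.2]⟩

theorem computes_const (x : ι → F) (code : List (Instr F ι)) (c : F) :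
    Computes x code (.const c) c := ⟨trivial, rfl⟩

theorem computes_inp (x : ι → F) (code : List (Instr F ι)) (i : ι) :
    Computes x code (.inp i) (x i) := ⟨trivial, rfl⟩

theorem spec_emit {x : ι → F} {code : List (Instr F ι)} {a b : Ref F ι} {v w : F} (o : FieldOp)
    (ha : Computes x code a v) (hb : Computes x code b w) :
    Spec code (emit o a b) 1 fun code' r => Computes x code' r (o.apply v w) := by
  intro hc
  refine ⟨List.prefix_append _ _, ?_, codeOk_concat.2 ⟨hc, ha.1, hb.1⟩, ?_, ?_⟩
  · show (code ++ [_]).length ≤ _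
    simp
  · show code.length < (code ++ [_]).length
    simp
  · show (Ref.reg code.length : Ref F ι).val x (runCode x (code ++ [_])) = _
    rw [runCode_concat, ha.2, hb.2]
    simp only [Ref.val]
    rw [← length_runCode x code]
    simp

omit [Field F] in
theorem Ref.Below.relocate {ι' : Type} {args : ι' → Ref F ι} {off k : ℕ} {a : Ref F ι'}
    (hargs : ∀ i, (args i).Below off) (ha : a.Below k) :
    (a.relocate args off).Below (off + k) := by
  cases a with
  | inp i => exact (hargs i).mono (by omega)
  | const c => trivial
  | reg j => exact Nat.add_lt_add_left (show j < k from ha) off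

theorem Ref.val_relocate {ι' : Type} {args : ι' → Ref F ι} {x : ι → F} {y : ι' → F}
    {mem mem' : List F} {a : Ref F ι'} (hb : ∀ i, (args i).Below mem.length)
    (hv : ∀ i, (args i).val x mem = y i) :
    (a.relocate args mem.length).val x (mem ++ mem') = a.val y mem' := by
  cases a with
  | inp i =>
    exact (Ref.val_of_prefix x (List.prefix_append _ _) (hb i)).trans (hv i)
  | const c => rfl
  | reg j =>
    simp only [Ref.relocate, Ref.val, List.getD_eq_getElem?_getD]
    rw [List.getElem?_append_right (by omega)]
    simp

/-- A subroutine behaves on its arguments as it does on its inputs, since its registers are those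
of the calling program from the current length on. -/
theorem spec_call {ι' κ : Type} {x : ι → F} {code : List (Instr F ι)} {P : SLP F ι' κ}
    {args : ι' → Ref F ι} {y : ι' → F} (hP : P.WellFormed)
    (hargs : ∀ i, Computes x code (args i) (y i)) :
    Spec code (call P args) P.cost fun code' o => ∀ k, Computes x code' (o k) (P.eval y k) := by
  intro hc
  set tr : Instr F ι' → Instr F ι := fun I =>
    ⟨I.op, I.lhs.relocate args code.length, I.rhs.relocate args code.length⟩ with htr
  have hb : ∀ i, (args i).Below (runCode x code).length := fun i => by
    rw [length_runCode]; exact (hargs i).1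
  -- running the translated instructions appends exactly the memory of the subroutine
  have key : ∀ l : List (Instr F ι'), CodeOk l →
      CodeOk (code ++ l.map tr) ∧
        runCode x (code ++ l.map tr) = runCode x code ++ runCode y l := by
    intro l
    induction l using List.reverseRecOn with
    | nil => intro _; simpa [runCode] using hc
    | append_singleton l I ih =>
      intro hl
      obtain ⟨h1, h2, h3⟩ := codeOk_concat.1 hl
      obtain ⟨ih1, ih2⟩ := ih h1
      rw [List.map_append, List.map_singleton, ← List.append_assoc]
      refine ⟨codeOk_concat.2 ⟨ih1, ?_, ?_⟩, ?_⟩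
      · simpa using h2.relocate (fun i => (hargs i).1)
      · simpa using h3.relocate (fun i => (hargs i).1)
      · rw [runCode_concat, ih2, runCode_concat, List.append_assoc]
        simp only [htr]
        rw [← length_runCode x code, Ref.val_relocate hb fun i => (hargs i).2,
          Ref.val_relocate hb fun i => (hargs i).2]
  obtain ⟨k1, k2⟩ := key P.code hP.1
  refine ⟨List.prefix_append _ _, ?_, k1, fun k => ⟨?_, ?_⟩⟩
  · show (code ++ P.code.map tr).length ≤ _
    simp [SLP.cost]
  · show ((P.out k).relocate args code.length).Below (code ++ P.code.map tr).length
    simpa using (hP.2 k).relocate (fun i => (hargs i).1)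
  · show ((P.out k).relocate args code.length).val x (runCode x (code ++ P.code.map tr)) = _
    rw [k2, ← length_runCode x code, Ref.val_relocate hb fun i => (hargs i).2]
    rfl

/-- Binary powering costs at most two multiplications per halving of the exponent. -/
theorem spec_powRef {x : ι → F} {a : Ref F ι} {v : F} (h : ℕ) :
    ∀ (e : ℕ) (code : List (Instr F ι)), Computes x code a v → e < 2 ^ h →
      Spec code (powRef a e) (2 * h) fun code' r => Computes x code' r (v ^ e) := by
  induction h with
  | zero =>
    intro e code ha he
    obtain rfl : e = 0 := by simpa using he
    rw [powRef]
    simpa using Spec.pure (computes_const x code 1)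
  | succ h ih =>
    intro e code ha he
    rw [powRef]
    by_cases h0 : e = 0
    · subst h0
      exact (Spec.pure (by simpa using computes_const x code (1 : F))).mono (by omega)
        fun _ _ _ h => h
    by_cases h1 : e = 1
    · subst h1
      exact (Spec.pure (by simpa using ha)).mono (by omega) fun _ _ _ h => h
    · rw [if_neg h0, if_neg h1]
      refine ((ih (e / 2) code ha (by rw [pow_succ] at he; omega)).bind
        (c₂ := 2) fun code₁ y h₁ hy => ?_).mono (by omega) fun _ _ _ h => h
      refine ((spec_emit .mul hy hy).bind (c₂ := 1) fun code₂ y2 h₂ hy2 => ?_)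
      simp only [FieldOp.apply, ← pow_add] at hy2
      split_ifs with h2
      · refine (spec_emit .mul hy2 (ha.mono (h₁.trans h₂))).mono le_rfl fun code₃ r _ hr => ?_
        have : v ^ e = v ^ (e / 2 + e / 2) * v := by rw [← pow_succ]; congr 1; omega
        rw [this]
        exact hr
      · refine (Spec.pure ?_).mono (Nat.zero_le 1) fun _ _ _ h => h
        rwa [show e / 2 + e / 2 = e by omega] at hy2

end Values

/-! ### Power series represented by lists of operands -/

section Series

open PowerSeries

variable {F : Type u} [Field F] {ι : Type}

/-- The list of operands `a` holds the coefficients of `p`; all coefficients from the length of `a`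
on are `0`, so that `p` is in fact a polynomial. -/
def ReprSeries (x : ι → F) (code : List (Instr F ι)) (a : List (Ref F ι)) (p : F⟦X⟧) : Prop :=
  ∀ i, Computes x code (coeffRef a i) (coeff i p)

variable {x : ι → F} {code : List (Instr F ι)}

theorem ReprSeries.mono {code' : List (Instr F ι)} (h : code <+: code') {a : List (Ref F ι)}
    {p : F⟦X⟧} (ha : ReprSeries x code a p) : ReprSeries x code' a p := fun i => (ha i).mono h

theorem coeffRef_of_length_le {a : List (Ref F ι)} {i : ℕ}
    (h : a.length ≤ i) : coeffRef a i = .const 0 :=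
  List.getD_eq_default _ _ h

theorem ReprSeries.coeff_eq_zero {a : List (Ref F ι)} {p : F⟦X⟧} (ha : ReprSeries x code a p)
    {i : ℕ} (h : a.length ≤ i) : coeff i p = 0 := by
  have := (ha i).2
  rw [coeffRef_of_length_le h] at this
  exact this.symm

theorem reprSeries_nil : ReprSeries x code [] (0 : F⟦X⟧) := fun i => by
  simpa [coeffRef] using computes_const x code (0 : F)

theorem reprSeries_singleton {u : Ref F ι} {v : F} (h : Computes x code u v) :
    ReprSeries x code [u] (C v : F⟦X⟧) := by
  intro i
  cases i with
  | zero => simpa [coeffRef] using h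
  | succ i => simpa [coeffRef, coeff_C] using computes_const x code (0 : F)

theorem reprSeries_one : ReprSeries x code [.const 1] (1 : F⟦X⟧) := by
  simpa using reprSeries_singleton (computes_const x code (1 : F))

theorem reprSeries_linear {w : Ref F ι} {v : F} (h : Computes x code w (0 - v)) :
    ReprSeries x code [.const 1, w] (1 - C v * X : F⟦X⟧) := by
  intro i
  match i with
  | 0 => simpa [coeffRef] using computes_const x code (1 : F)
  | 1 => simpa [coeffRef, coeff_one] using h
  | i + 2 =>
    simpa [coeffRef, coeff_one, coeff_succ_mul_X, coeff_C] using computes_const x code (0 : F)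

theorem coeffRef_take (a : List (Ref F ι)) (n i : ℕ) :
    coeffRef (a.take n) i = if i < n then coeffRef a i else .const 0 := by
  simp only [coeffRef, List.getD_eq_getElem?_getD, List.getElem?_take]
  split_ifs <;> rfl

theorem ReprSeries.take {a : List (Ref F ι)} {p : F⟦X⟧} (ha : ReprSeries x code a p) (n : ℕ) :
    ∃ p', ReprSeries x code (a.take n) p' ∧ X ^ n ∣ p' - p := by
  refine ⟨mk fun i => if i < n then coeff i p else 0, fun i => ?_, ?_⟩
  · rw [coeffRef_take, coeff_mk]
    split_ifs
    · exact ha i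
    · exact computes_const x code 0
  · rw [X_pow_dvd_iff]
    intro m hm
    simp [hm]

/-- The multiplication routine is correct, and costs at most `Λ` operations per coefficient for all
sizes up to `D`. Fixing the size limit turns all soft-oh bounds into linear ones. -/
def PolyMulSpec (pm : ∀ d : ℕ, SLP F (Fin d ⊕ Fin d) (Fin (2 * d - 1))) (Λ D : ℕ) : Prop :=
  ∀ d : ℕ, (pm d).WellFormed ∧
    (∀ a b : Fin d → F, ∀ t : Fin (2 * d - 1),
      (pm d).eval (Sum.elim a b) t = (polyOfCoeffs a * polyOfCoeffs b).coeff (t : ℕ)) ∧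
    (d ≤ D → (pm d).cost ≤ Λ * d)

theorem coe_polyOfCoeffs {d : ℕ} {p : F⟦X⟧} (h : ∀ i, d ≤ i → coeff i p = 0) :
    ((polyOfCoeffs fun i : Fin d => coeff i p : Polynomial F) : F⟦X⟧) = p := by
  ext i
  rw [Polynomial.coeff_coe, polyOfCoeffs, Polynomial.finsetSum_coeff]
  simp only [Polynomial.coeff_monomial]
  rcases lt_or_ge i d with hi | hi
  · rw [Finset.sum_eq_single ⟨i, hi⟩]
    · simp
    · intro b _ hb
      exact if_neg fun h => hb (Fin.ext h)
    · simp
  · rw [h i hi]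
    refine Finset.sum_eq_zero fun b _ => if_neg ?_
    have := b.2
    omega

theorem spec_polyZip {a b : List (Ref F ι)} {p q r : F⟦X⟧} (o : FieldOp)
    (ha : ReprSeries x code a p) (hb : ReprSeries x code b q)
    (hr : ∀ i, o.apply (coeff i p) (coeff i q) = coeff i r) :
    Spec code (polyZip o a b) (max a.length b.length) fun code' l =>
      l.length = max a.length b.length ∧
        ((o.apply (0 : F) 0 = 0) → ReprSeries x code' l r) := by
  refine (Spec.mapM_range (c := fun _ => 1)
    (R := fun i code' r' => Computes x code' r' (coeff i r))
    (fun _ _ _ _ h h' => h'.mono h) fun i _ code' h => ?_).mono (by simp) ?_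
  · rw [← hr]
    exact spec_emit o ((ha i).mono h) ((hb i).mono h)
  · rintro code' l - ⟨h1, h2⟩
    refine ⟨h1, fun h0 i => ?_⟩
    rcases lt_or_ge i (max a.length b.length) with hi | hi
    · exact h2 i hi _
    · rw [coeffRef_of_length_le (by omega), ← hr,
        ha.coeff_eq_zero (by omega), hb.coeff_eq_zero (by omega), h0]
      exact computes_const x code' 0

theorem spec_polyAdd {a b : List (Ref F ι)} {p q : F⟦X⟧}
    (ha : ReprSeries x code a p) (hb : ReprSeries x code b q) :
    Spec code (polyZip .add a b) (max a.length b.length) fun code' l =>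
      l.length = max a.length b.length ∧ ReprSeries x code' l (p + q) :=
  (spec_polyZip (r := p + q) .add ha hb fun i => by simp [FieldOp.apply]).mono le_rfl
    fun _ _ _ h => ⟨h.1, h.2 (by simp [FieldOp.apply])⟩

theorem spec_polySub {a b : List (Ref F ι)} {p q : F⟦X⟧}
    (ha : ReprSeries x code a p) (hb : ReprSeries x code b q) :
    Spec code (polyZip .sub a b) (max a.length b.length) fun code' l =>
      l.length = max a.length b.length ∧ ReprSeries x code' l (p - q) :=
  (spec_polyZip (r := p - q) .sub ha hb fun i => by simp [FieldOp.apply]).mono le_rfl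
    fun _ _ _ h => ⟨h.1, h.2 (by simp [FieldOp.apply])⟩

variable {pm : ∀ d : ℕ, SLP F (Fin d ⊕ Fin d) (Fin (2 * d - 1))} {Λ D : ℕ}

theorem spec_polyMul (hpm : PolyMulSpec pm Λ D) {a b : List (Ref F ι)} {p q : F⟦X⟧} {d : ℕ}
    (ha : ReprSeries x code a p) (hb : ReprSeries x code b q) (had : a.length ≤ d)
    (hbd : b.length ≤ d) (hd : d ≤ D) :
    Spec code (polyMul pm a b) (Λ * d) fun code' l =>
      l.length = a.length + b.length - 1 ∧ ReprSeries x code' l (p * q) := by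
  obtain ⟨hw, he, hc⟩ := hpm (max a.length b.length)
  have hcost : (pm (max a.length b.length)).cost ≤ Λ * d :=
    (hc (by omega)).trans (Nat.mul_le_mul_left _ (by omega))
  have hcall := spec_call (x := x) (code := code) hw
    (args := Sum.elim (fun i : Fin _ => coeffRef a i) (fun i : Fin _ => coeffRef b i))
    (y := Sum.elim (fun i : Fin _ => coeff i p) (fun i : Fin _ => coeff i q))
    (by rintro (i | i); exacts [ha i, hb i])
  refine Spec.mono (hcall.bind fun code' res _ hres => Spec.pure ?_ : Spec _ _ (_ + 0) _) hcost
    fun _ _ _ h => h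
  refine ⟨by simp; omega, fun i => ?_⟩
  rw [coeffRef_take]
  split_ifs with hi
  · have hi' : i < 2 * max a.length b.length - 1 := by omega
    have := hres ⟨i, hi'⟩
    rw [he, ← Polynomial.coeff_coe, Polynomial.coe_mul,
      coe_polyOfCoeffs fun i hi => ha.coeff_eq_zero (by omega),
      coe_polyOfCoeffs fun i hi => hb.coeff_eq_zero (by omega)] at this
    rw [coeffRef, List.getD_eq_getElem _ _ (by simpa using hi')]
    simpa using this
  · have : coeff i (p * q) = 0 := by
      rw [coeff_mul]
      refine Finset.sum_eq_zero fun z hz => ?_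
      rw [Finset.HasAntidiagonal.mem_antidiagonal] at hz
      rcases lt_or_ge z.1 a.length with h | h
      · rw [hb.coeff_eq_zero (show b.length ≤ z.2 by omega), mul_zero]
      · rw [ha.coeff_eq_zero h, zero_mul]
    rw [this]
    exact computes_const x code' 0

/-- The power series `∑ u / (1 - v x)` over the pairs `(u, v)` of a list. -/
def fractionSeries (w : List (F × F)) : F⟦X⟧ := mk fun j => (w.map fun z => z.1 * z.2 ^ j).sum

theorem fractionSeries_append (w w' : List (F × F)) :
    fractionSeries (w ++ w') = fractionSeries w + fractionSeries w' := by
  ext j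
  simp [fractionSeries]

theorem fractionSeries_singleton (u v : F) :
    (1 - C v * X) * fractionSeries [(u, v)] = C u := by
  ext j
  rw [sub_mul, one_mul, map_sub, mul_assoc, coeff_C_mul]
  cases j with
  | zero => simp [fractionSeries]
  | succ j => simp [fractionSeries, coeff_succ_X_mul]; ring

/-- The pairs of operands in `l` hold the pairs of values in `w`. -/
def ReprPairs (x : ι → F) (code : List (Instr F ι)) (l : List (Ref F ι × Ref F ι))
    (w : List (F × F)) : Prop :=
  List.Forall₂ (fun a z => Computes x code a.1 z.1 ∧ Computes x code a.2 z.2) l w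

theorem ReprPairs.mono {code' : List (Instr F ι)} (h : code <+: code')
    {l : List (Ref F ι × Ref F ι)} {w : List (F × F)} (hl : ReprPairs x code l w) :
    ReprPairs x code' l w :=
  hl.imp fun _ _ h' => ⟨h'.1.mono h, h'.2.mono h⟩

/-- `p` and `q` hold a numerator and a denominator of `S`, the latter with constant
coefficient `1`. -/
def ReprFraction (x : ι → F) (code : List (Instr F ι)) (p q : List (Ref F ι)) (S : F⟦X⟧) : Prop :=
  ∃ P Q : F⟦X⟧, ReprSeries x code p P ∧ ReprSeries x code q Q ∧ P = Q * S ∧ constantCoeff Q = 1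

/-- The product tree on at most `2 ^ h` fractions has `h` levels, with at most `3 Λ + 1` operations
per fraction on each level. -/
theorem spec_sumFractions (hpm : PolyMulSpec pm Λ D) (h : ℕ) :
    ∀ (l : List (Ref F ι × Ref F ι)) (w : List (F × F)) (code : List (Instr F ι)),
      ReprPairs x code l w → l.length ≤ 2 ^ h → l.length ≤ D →
      Spec code (sumFractions pm l) ((3 * Λ + 1) * l.length * h + l.length) fun code' r =>
        r.1.length = l.length ∧ r.2.length = l.length + 1 ∧
          ReprFraction x code' r.1 r.2 (fractionSeries w) := by
  have h_nil : ∀ (w : List (F × F)) (code : List (Instr F ι)), ReprPairs x code [] w →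
      Spec code (sumFractions pm []) 0 fun code' r =>
        r.1.length = 0 ∧ r.2.length = 1 ∧
          ReprFraction x code' r.1 r.2 (fractionSeries w) := by
    intro w code hw
    rw [sumFractions]
    cases hw
    refine Spec.pure ⟨rfl, rfl, 0, 1, reprSeries_nil, reprSeries_one, ?_, by simp⟩
    ext j
    simp [fractionSeries]
  have h_one : ∀ (uv : Ref F ι × Ref F ι) (w : List (F × F)) (code : List (Instr F ι)),
      ReprPairs x code [uv] w → Spec code (sumFractions pm [uv]) 1 fun code' r =>
        r.1.length = 1 ∧ r.2.length = 1 + 1 ∧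
          ReprFraction x code' r.1 r.2 (fractionSeries w) := by
    rintro ⟨u, v⟩ w code hw
    rw [sumFractions]
    obtain ⟨⟨u', v'⟩, w', hz, hnil, rfl⟩ := List.forall₂_cons_left_iff.1 hw
    cases hnil
    refine Spec.bind (c₁ := 1) (c₂ := 0) (spec_emit .sub (computes_const x code 0) hz.2)
      fun code₁ r h₁ hr => Spec.pure ?_
    exact ⟨rfl, rfl, C u', 1 - C v' * X, reprSeries_singleton (hz.1.mono h₁),
      reprSeries_linear hr, (fractionSeries_singleton u' v').symm, by simp⟩
  induction h with
  | zero =>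
    intro l w code hw hl _
    match l, hw, hl with
    | [], hw, _ => exact (h_nil w code hw).mono (by simp) fun _ _ _ h => h
    | [uv], hw, _ => exact (h_one uv w code hw).mono (by simp) fun _ _ _ h => h
    | _ :: _ :: _, _, hl => simp at hl
  | succ h ih =>
    intro l w code hw hl hD
    match l, hw, hl, hD with
    | [], hw, _, _ => exact (h_nil w code hw).mono (by simp) fun _ _ _ h => h
    | [uv], hw, _, _ => exact (h_one uv w code hw).mono (by simp) fun _ _ _ h => h
    | a :: b :: l, hw, hl, hD =>
      rw [sumFractions]
      set L := a :: b :: l with hL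
      set k := (l.length + 2) / 2 with hk
      have hlen : L.length = l.length + 2 := by simp [hL]
      have hl₁ : (L.take k).length = k := by rw [List.length_take]; omega
      have hl₂ : (L.drop k).length = L.length - k := List.length_drop
      rw [pow_succ] at hl
      have hcost : ((3 * Λ + 1) * k * h + k) + (((3 * Λ + 1) * (L.length - k) * h +
          (L.length - k)) + (Λ * L.length + (Λ * L.length + (L.length + (Λ * L.length + 0))))) ≤
          (3 * Λ + 1) * L.length * (h + 1) + L.length := by
        obtain ⟨m, hm⟩ : ∃ m, L.length = k + m := ⟨L.length - k, by omega⟩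
        rw [hm, Nat.add_sub_cancel_left]
        exact le_of_eq (by ring)
      refine Spec.mono ?_ hcost fun _ _ _ h => h
      have s₁ := ih (L.take k) (w.take k) code (List.forall₂_take k hw) (by omega) (by omega)
      rw [hl₁] at s₁
      refine s₁.bind ?_
      rintro code₁ ⟨p₁, q₁⟩ g₁ ⟨lp₁, lq₁, P₁, Q₁, rp₁, rq₁, e₁, c₁⟩
      have s₂ := ih (L.drop k) (w.drop k) code₁ (List.forall₂_drop k (hw.mono g₁)) (by omega)
        (by omega)
      rw [hl₂] at s₂
      refine s₂.bind ?_
      rintro code₂ ⟨p₂, q₂⟩ g₂ ⟨lp₂, lq₂, P₂, Q₂, rp₂, rq₂, e₂, c₂⟩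
      replace rp₁ := rp₁.mono g₂
      replace rq₁ := rq₁.mono g₂
      simp only at lp₁ lq₁ lp₂ lq₂ rp₁ rq₁ rp₂ rq₂
      refine (spec_polyMul hpm (d := L.length) rp₁ rq₂ (by omega) (by omega) hD).bind ?_
      rintro code₃ A g₃ ⟨lA, rA⟩
      replace rp₂ := rp₂.mono g₃
      replace rq₂ := rq₂.mono g₃
      replace rq₁ := rq₁.mono g₃
      refine (spec_polyMul hpm (d := L.length) rp₂ rq₁ (by omega) (by omega) hD).bind ?_
      rintro code₄ B g₄ ⟨lB, rB⟩
      replace rA := rA.mono g₄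
      replace rq₂ := rq₂.mono g₄
      replace rq₁ := rq₁.mono g₄
      refine ((spec_polyAdd rA rB).mono (c' := L.length) (by omega) fun _ _ _ h => h).bind ?_
      rintro code₅ p g₅ ⟨lp, rp⟩
      replace rq₂ := rq₂.mono g₅
      replace rq₁ := rq₁.mono g₅
      refine (spec_polyMul hpm (d := L.length) rq₁ rq₂ (by omega) (by omega) hD).bind ?_
      rintro code₆ q g₆ ⟨lq, rq⟩
      refine Spec.pure ⟨?_, ?_, _, _, rp.mono g₆, rq, ?_, by simp [c₁, c₂]⟩
      · show p.length = _
        omega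
      · show q.length = _
        omega
      · conv_rhs => rw [← List.take_append_drop k w]
        rw [fractionSeries_append, e₁, e₂]
        ring

/-- Newton iteration doubles the precision: if `q g = 1` modulo `x ^ (2 ^ t)`, then
`q (g + g (1 - q g)) - 1 = -(q g - 1) ^ 2` vanishes modulo `x ^ (2 ^ (t + 1))`. The cost of the last
step dominates. -/
theorem spec_invSeries (hpm : PolyMulSpec pm Λ D) {q : List (Ref F ι)} {Q : F⟦X⟧}
    (hQ : constantCoeff Q = 1) (T : ℕ) (hT : T = 0 ∨ 2 ^ T ≤ D) (hq : ReprSeries x code q Q) :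
    Spec code (invSeries pm q T) ((4 * Λ + 4) * (2 ^ T - 1)) fun code' g =>
      g.length ≤ 2 ^ T ∧ ∃ G, ReprSeries x code' g G ∧ X ^ (2 ^ T) ∣ Q * G - 1 := by
  induction T with
  | zero =>
    refine (Spec.pure ⟨by simp, 1, reprSeries_one, ?_⟩).mono (Nat.zero_le _) fun _ _ _ h => h
    rw [pow_zero, pow_one, X_dvd_iff]
    simp [hQ]
  | succ t ih =>
    have hD : 2 ^ (t + 1) ≤ D := by simpa using hT
    have h2 : 2 ^ (t + 1) = 2 * 2 ^ t := by ring
    have hpos : 0 < 2 ^ t := by positivity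
    have hcost : (4 * Λ + 4) * (2 ^ t - 1) + (Λ * 2 ^ (t + 1) + (2 ^ (t + 1) +
        (Λ * 2 ^ (t + 1) + 2 ^ (t + 1)))) ≤ (4 * Λ + 4) * (2 ^ (t + 1) - 1) := by
      obtain ⟨m, hm⟩ : ∃ m, 2 ^ t = m + 1 := ⟨2 ^ t - 1, by omega⟩
      rw [h2, hm, show 2 * (m + 1) - 1 = 2 * m + 1 by omega, Nat.add_sub_cancel]
      exact le_of_eq (by ring)
    refine Spec.mono ?_ hcost fun _ _ _ h => h
    rw [invSeries]
    refine (ih (Or.inr (by omega))).bind ?_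
    rintro code₁ g g₁ ⟨lg, G, rG, hG⟩
    obtain ⟨Q', rQ', δ₃, hδ₃⟩ := (hq.mono g₁).take (2 ^ (t + 1))
    refine (spec_polyMul hpm (d := 2 ^ (t + 1)) rQ' rG (by rw [List.length_take]; omega)
      (by omega) hD).bind ?_
    rintro code₂ H g₂ ⟨-, rH⟩
    obtain ⟨H', rH', δ₂, hδ₂⟩ := rH.take (2 ^ (t + 1))
    refine ((spec_polySub reprSeries_one rH').mono (c' := 2 ^ (t + 1))
      (by rw [List.length_take, List.length_singleton]; omega) fun _ _ _ h => h).bind ?_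
    rintro code₃ e g₃ ⟨le, re⟩
    rw [List.length_take, List.length_singleton] at le
    refine (spec_polyMul hpm (d := 2 ^ (t + 1)) (rG.mono (g₂.trans g₃)) re (by omega)
      (by omega) hD).bind ?_
    rintro code₄ ge g₄ ⟨-, rge⟩
    obtain ⟨E', rE', δ₁, hδ₁⟩ := rge.take (2 ^ (t + 1))
    refine (spec_polyAdd (rG.mono (g₂.trans (g₃.trans g₄))) rE').mono
      (by rw [List.length_take]; omega) ?_
    rintro code₅ y g₅ ⟨ly, ry⟩
    rw [List.length_take] at ly
    refine ⟨by omega, _, ry, ?_⟩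
    obtain ⟨ε, hε⟩ := hG
    have hX : (X : F⟦X⟧) ^ 2 ^ (t + 1) = (X ^ 2 ^ t) ^ 2 := by rw [← pow_mul, pow_succ]
    refine ⟨-ε ^ 2 + Q * δ₁ - Q * G * (δ₂ + δ₃ * G), ?_⟩
    have e3 : Q' = Q + X ^ 2 ^ (t + 1) * δ₃ := by rw [← hδ₃]; ring
    have e2 : H' = Q' * G + X ^ 2 ^ (t + 1) * δ₂ := by rw [← hδ₂]; ring
    have e1 : E' = G * (1 - H') + X ^ 2 ^ (t + 1) * δ₁ := by rw [← hδ₁]; ring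
    have e0 : (X ^ 2 ^ (t + 1)) * ε ^ 2 = (Q * G - 1) ^ 2 := by rw [hε, hX]; ring
    rw [e1, e2, e3]
    linear_combination e0

/-- The first `N` coefficients of a sum of `n` fractions cost `O(n + N)` operations, up to the
logarithmic factors `Λ` and `h`. -/
theorem spec_transposedVandermonde (hpm : PolyMulSpec pm Λ D) {N h : ℕ} (hN : 2 * N ≤ D)
    {l : List (Ref F ι × Ref F ι)} {w : List (F × F)} (hw : ReprPairs x code l w)
    (hl : l.length ≤ 2 ^ h) (hD : l.length ≤ D) :
    Spec code (transposedVandermonde pm N l) ((9 * Λ + 8) * (h + 1) * (l.length + N))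
      fun code' y => ∀ j, Computes x code' (coeffRef y j)
        (if j < N then (w.map fun z => z.1 * z.2 ^ j).sum else 0) := by
  have hclog : 2 ^ Nat.clog 2 N ≤ 2 * N ∨ Nat.clog 2 N = 0 := by
    rcases Nat.lt_or_ge 1 N with h1 | h1
    · left
      have h2 : 0 < Nat.clog 2 N := Nat.clog_pos (by norm_num) h1
      have := Nat.pow_pred_clog_lt_self (b := 2) (by norm_num) h1
      obtain ⟨m, hm⟩ : ∃ m, Nat.clog 2 N = m + 1 := ⟨Nat.clog 2 N - 1, by omega⟩
      rw [hm] at this ⊢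
      rw [pow_succ]
      simp only [Nat.pred_succ] at this
      omega
    · right
      exact Nat.clog_of_right_le_one h1 2
  have hpow : 2 ^ Nat.clog 2 N - 1 ≤ 2 * N := by
    rcases hclog with h' | h'
    · omega
    · simp [h']
  have hcost : ((3 * Λ + 1) * l.length * h + l.length) + ((4 * Λ + 4) * (2 ^ Nat.clog 2 N - 1) +
      (Λ * N + 0)) ≤ (9 * Λ + 8) * (h + 1) * (l.length + N) := by
    have h1 : (4 * Λ + 4) * (2 ^ Nat.clog 2 N - 1) ≤ (4 * Λ + 4) * (2 * N) :=
      Nat.mul_le_mul_left _ hpow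
    have h2 : (9 * Λ + 8) * (h + 1) * (l.length + N) = ((3 * Λ + 1) * l.length * h + l.length) +
      ((4 * Λ + 4) * (2 * N) + (Λ * N + 0)) + ((6 * Λ + 7) * l.length * h + (9 * Λ + 7) * l.length +
        (9 * Λ + 8) * h * N) := by ring
    rw [h2]
    exact le_trans (by omega) (Nat.le_add_right _ _)
  refine Spec.mono ?_ hcost fun _ _ _ h => h
  unfold transposedVandermonde
  refine (spec_sumFractions hpm h l w code hw hl hD).bind ?_
  rintro code₁ ⟨p, q⟩ g₁ ⟨-, -, P, Q, rp, rq, hP, hQ⟩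
  simp only at rp rq
  refine (spec_invSeries hpm hQ _ (hclog.symm.imp_right (·.trans hN)) rq).bind ?_
  rintro code₂ g g₂ ⟨-, G, rG, hG⟩
  obtain ⟨P', rP', hP'⟩ := (rp.mono g₂).take N
  obtain ⟨G', rG', hG'⟩ := rG.take N
  refine (spec_polyMul hpm (d := N) rP' rG' (by simp) (by simp) (by omega)).bind ?_
  rintro code₃ y g₃ ⟨-, ry⟩
  refine Spec.pure fun j => ?_
  rw [coeffRef_take]
  split_ifs with hj
  · have hdvd : X ^ N ∣ P' * G' - fractionSeries w := by
      have h1 : X ^ N ∣ Q * G - 1 :=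
        (pow_dvd_pow X (Nat.le_pow_clog (by norm_num) N)).trans hG
      have : P' * G' - fractionSeries w =
          (P' - P) * G' + P * (G' - G) + (Q * G - 1) * fractionSeries w := by
        rw [hP]; ring
      rw [this]
      exact dvd_add (dvd_add (hP'.mul_right _) (hG'.mul_left _)) (h1.mul_right _)
    have := X_pow_dvd_iff.1 hdvd j hj
    rw [map_sub, sub_eq_zero] at this
    have h3 := ry j
    rw [this] at h3
    simpa [fractionSeries] using h3
  · exact computes_const x code₃ 0

end Series

/-! ### Sparse and dense matrix multiplication -/

section Matrices

variable {F : Type u} [Field F] {ι : Type} {x : ι → F} {code : List (Instr F ι)}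

/-- The operand at each position of `M` holds the entry of `f` at that position. -/
def ReprMatrix (x : ι → F) (code : List (Instr F ι)) (M : ℕ → ℕ → Ref F ι) (f : ℕ → ℕ → F) :
    Prop :=
  ∀ i j, Computes x code (M i j) (f i j)

theorem ReprMatrix.mono {code' : List (Instr F ι)} (h : code <+: code') {M : ℕ → ℕ → Ref F ι}
    {f : ℕ → ℕ → F} (hM : ReprMatrix x code M f) : ReprMatrix x code' M f :=
  fun i j => (hM i j).mono h

theorem foldl_add_eq_add_sum {α M : Type*} [AddCommMonoid M] (φ : α → M) (l : List α) (v : M) :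
    l.foldl (fun w a => w + φ a) v = v + (l.map φ).sum := by
  induction l generalizing v with
  | nil => simp
  | cons a l ih => rw [List.foldl_cons, ih, List.map_cons, List.sum_cons, add_assoc]

/-- Only the positions in `cols` contribute to the result; each costs two operations per column
of `Y`. -/
theorem spec_sparseMul {r N : ℕ} {cols : ℕ → List ℕ} {X Y : ℕ → ℕ → Ref F ι} {f g : ℕ → ℕ → F}
    (hX : ReprMatrix x code X f) (hY : ReprMatrix x code Y g) :
    Spec code (sparseMul r N cols X Y) (∑ i ∈ Finset.range r, N * ((cols i).length * 2))
      fun code' Z => ∀ i < r, ∀ j < N,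
        Computes x code' (Z i j) ((cols i).map fun k => f i k * g k j).sum := by
  unfold sparseMul
  refine Spec.bind (c₁ := ∑ i ∈ Finset.range r, N * ((cols i).length * 2)) (c₂ := 0)
    (Spec.mapM_range (c := fun i => N * ((cols i).length * 2)) (R := fun i code' row =>
        ∀ j < N, ∀ d, Computes x code' (List.getD row j d)
          ((cols i).map fun k => f i k * g k j).sum)
      (fun i row c c' h h' j hj d => (h' j hj d).mono h) fun i _ code₁ g₁ => ?_) ?_
  · refine (Spec.mapM_range (c := fun _ => (cols i).length * 2)
      (R := fun j code' b => Computes x code' b ((cols i).map fun k => f i k * g k j).sum)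
      (fun _ _ _ _ h h' => h'.mono h) fun j _ code₂ g₂ => ?_).mono (by simp)
      fun _ _ _ h => h.2
    refine (Spec.foldlM (Rep := Computes x) (step := fun w k => w + f i k * g k j) (cols i)
      (fun k _ code₃ b w g₃ hb => ?_) (computes_const x code₂ 0)).mono le_rfl fun _ _ _ h => ?_
    · have g' := g₁.trans (g₂.trans g₃)
      exact Spec.bind (c₁ := 1) (c₂ := 1) (spec_emit .mul ((hX i k).mono g') ((hY k j).mono g'))
        fun code₄ z g₄ hz => spec_emit .add (hb.mono g₄) hz
    · rwa [foldl_add_eq_add_sum, zero_add] at h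
  · rintro code₁ Z - ⟨-, h⟩
    exact Spec.pure fun i hi j hj => h i hi _ j hj _

theorem sum_range_mul_eq_sum_blocks {M : Type*} [AddCommMonoid M] (φ : ℕ → M) (m n : ℕ) :
    ∑ k ∈ Finset.range (n * m), φ k =
      ∑ K ∈ Finset.range n, ∑ a ∈ Finset.range m, φ (K * m + a) := by
  induction n with
  | zero => simp
  | succ n ih => rw [Nat.succ_mul, Finset.sum_range_add, ih, Finset.sum_range_succ]

theorem lt_ceilDiv_of_div {i m r : ℕ} (hm : 0 < m) (hi : i < r) : i / m < r ⌈/⌉ m := by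
  have h : r ≤ m * (r ⌈/⌉ m) := by simpa using le_smul_ceilDiv (b := r) hm
  exact Nat.div_lt_of_lt_mul (lt_of_lt_of_le hi h)

/-- The size of the blocks in `denseMul`. -/
def blockSize (r ℓ N : ℕ) : ℕ := max 1 (min r (min ℓ N))

/-- The operands outside the index range are multiplied along in the blocks at the border. They
do no harm since the columns of `X` from `ℓ` on are zero. -/
theorem spec_denseMul {mm : ∀ m : ℕ, SLP F ((Fin m × Fin m) ⊕ (Fin m × Fin m)) (Fin m × Fin m)}
    (hw : ∀ m, (mm m).WellFormed)
    (he : ∀ m, ∀ X Y : Matrix (Fin m) (Fin m) F, ∀ i j : Fin m,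
      (mm m).eval (Sum.elim (fun p => X p.1 p.2) (fun p => Y p.1 p.2)) (i, j) = (X * Y) i j)
    {r ℓ N m : ℕ} (hm : m = blockSize r ℓ N) {X Y : ℕ → ℕ → Ref F ι} {f g : ℕ → ℕ → F}
    (hX : ReprMatrix x code X f) (hY : ReprMatrix x code Y g) (hf : ∀ i k, ℓ ≤ k → f i k = 0) :
    Spec code (denseMul mm r ℓ N X Y)
      ((r ⌈/⌉ m) * ((N ⌈/⌉ m) * ((ℓ ⌈/⌉ m) * ((mm m).cost + m * m))))
      fun code' Z => ∀ i < r, ∀ j < N,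
        Computes x code' (Z i j) (∑ k ∈ Finset.range ℓ, f i k * g k j) := by
  have hm0 : 0 < m := by rw [hm, blockSize]; omega
  unfold denseMul
  rw [blockSize] at hm
  dsimp only
  generalize max 1 (min r (min ℓ N)) = m' at hm ⊢
  subst hm
  -- the value represented by the block `(I, J)` of the result
  set val : ℕ → ℕ → Fin m → Fin m → F := fun I J a b =>
    ∑ k ∈ Finset.range ℓ, f (I * m + a) k * g k (J * m + b) with hval
  refine Spec.bind (c₁ := (r ⌈/⌉ m) * ((N ⌈/⌉ m) * ((ℓ ⌈/⌉ m) * ((mm m).cost + m * m)))) (c₂ := 0)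
    ((Spec.mapM_range (c := fun _ => (N ⌈/⌉ m) * ((ℓ ⌈/⌉ m) * ((mm m).cost + m * m)))
      (R := fun I code' (row : List (List (List (Ref F ι)))) => ∀ J < N ⌈/⌉ m, ∀ d, ∀ a b : Fin m,
        Computes x code' (coeffRef ((List.getD row J d).getD a []) b) (val I J a b))
      (fun I row c c' h h' J hJ d a b => (h' J hJ d a b).mono h) fun I _ code₁ g₁ => ?_).mono
      (by simp) fun _ _ _ h => h.2) ?_
  · refine (Spec.mapM_range (c := fun _ => (ℓ ⌈/⌉ m) * ((mm m).cost + m * m))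
      (R := fun J code' (acc : List (List (Ref F ι))) => ∀ a b : Fin m,
        Computes x code' (coeffRef (acc.getD a []) b) (val I J a b))
      (fun J row c c' h h' a b => (h' a b).mono h) fun J _ code₂ g₂ => ?_).mono
      (by simp) fun _ _ _ h => h.2
    set φ : ℕ → Fin m → Fin m → F := fun K a b =>
      ∑ c : Fin m, f (I * m + a) (K * m + c) * g (K * m + c) (J * m + b) with hφ
    refine (Spec.foldlM (Rep := fun c acc v => ∀ a b : Fin m,
        Computes x c (coeffRef (acc.getD a []) b) (v a b)) (c := (mm m).cost + m * m)
      (step := fun v K => v + φ K) (List.range (ℓ ⌈/⌉ m)) (v := 0)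
      (fun K _ code₃ acc v g₃ hacc => ?_) fun a b => ?_).mono (by simp) fun code₄ acc _ h a b => ?_
    · have g' := g₁.trans (g₂.trans g₃)
      refine (spec_call (hw m) (x := x) (y := Sum.elim
        (fun p : Fin m × Fin m => f (I * m + p.1) (K * m + p.2))
        (fun p : Fin m × Fin m => g (K * m + p.1) (J * m + p.2))) ?_).bind ?_
      · rintro (p | p)
        · exact (hX _ _).mono g'
        · exact (hY _ _).mono g'
      · intro code₄ p g₄ hp
        have hp' : ∀ a b : Fin m, Computes x code₄ (p (a, b)) (φ K a b) := by
          intro a b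
          have e := he m (Matrix.of fun a c => f (I * m + a) (K * m + c))
            (Matrix.of fun c b => g (K * m + c) (J * m + b)) a b
          rw [Matrix.mul_apply] at e
          simp only [Matrix.of_apply] at e
          have := hp (a, b)
          rwa [e] at this
        refine (Spec.mapM_finRange (c := m)
          (R := fun a code' row => ∀ (b : Fin m) (d : Ref F ι),
            Computes x code' (List.getD row b d) (v a b + φ K a b))
          (fun a row c c' h h' b d => (h' b d).mono h) fun a code₅ g₅ => ?_).mono le_rfl
          fun _ _ _ h a b => h a [] b _
        refine (Spec.mapM_finRange (c := 1) (R := fun b code' y =>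
            Computes x code' y (v a b + φ K a b)) (fun _ _ _ _ h h' => h'.mono h)
          fun b code₆ g₆ => ?_).mono (by simp) fun _ _ _ h => h
        exact spec_emit .add ((hacc a b).mono (g₄.trans (g₅.trans g₆)))
          ((hp' a b).mono (g₅.trans g₆))
    · simpa [coeffRef] using computes_const x code₂ (0 : F)
    · have hle : ℓ ≤ (ℓ ⌈/⌉ m) * m := by
        simpa [mul_comm] using le_smul_ceilDiv (b := ℓ) hm0
      have : val I J a b =
          (List.foldl (fun v K => v + φ K) 0 (List.range (ℓ ⌈/⌉ m))) a b := by
        rw [foldl_add_eq_add_sum, zero_add, ← List.sum_toFinset _ List.nodup_range,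
          List.toFinset_range, Finset.sum_apply, Finset.sum_apply, hval]
        simp only
        rw [Finset.sum_subset (Finset.range_subset_range.2 hle) fun k _ hk => by
          rw [hf _ _ (by simpa using hk), zero_mul], sum_range_mul_eq_sum_blocks]
        exact Finset.sum_congr rfl fun K _ => Finset.sum_range _
      rw [this]
      exact h a b
  · intro code₁ Z _ h
    refine Spec.pure fun i hi j hj => ?_
    have := h (i / m) (lt_ceilDiv_of_div hm0 hi) [] (j / m) (lt_ceilDiv_of_div hm0 hj) []
      ⟨i % m, Nat.mod_lt _ hm0⟩ ⟨j % m, Nat.mod_lt _ hm0⟩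
    simpa only [hval, Nat.div_add_mod'] using this

end Matrices

/-! ### Nonzero entries of matrices -/

section SparseRepresentation

variable {F : Type u} [Field F] [DecidableEq F] {p q : ℕ}

/-- The entries of a matrix, continued by `0` outside the index range. -/
def extendZero (M : Matrix (Fin p) (Fin q) F) (i j : ℕ) : F :=
  if h : i < p ∧ j < q then M ⟨i, h.1⟩ ⟨j, h.2⟩ else 0

omit [DecidableEq F] in
theorem extendZero_val (M : Matrix (Fin p) (Fin q) F) (i : Fin p) (j : Fin q) :
    extendZero M i j = M i j := by
  simp [extendZero]

theorem reprMatrix_sparseRef {ι : Type} {x : ι → F} {code : List (Instr F ι)}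
    {M : Matrix (Fin p) (Fin q) F} {e : Fin p → Fin q → ι} (h : ∀ i j, x (e i j) = M i j) :
    ReprMatrix x code (sparseRef (nonzeros M) e) (extendZero M) := by
  intro i j
  unfold sparseRef extendZero
  split_ifs with h1 h2
  · rw [← h]
    exact computes_inp _ _ _
  · have : M ⟨i, h1.1⟩ ⟨j, h1.2⟩ = 0 := by simpa [nonzeros] using h2
    rw [this]
    exact computes_const x code 0
  · exact computes_const x code 0

theorem mem_rowCols {S : Finset (Fin p × Fin q)} {i j : ℕ} :
    j ∈ rowCols S i ↔ ∃ z ∈ S, (z.1 : ℕ) = i ∧ (z.2 : ℕ) = j := by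
  simp only [rowCols, List.mem_filter, List.mem_range, decide_eq_true_eq, and_iff_right_iff_imp]
  rintro ⟨z, -, -, rfl⟩
  exact z.2.2

theorem nodup_rowCols (S : Finset (Fin p × Fin q)) (i : ℕ) : (rowCols S i).Nodup :=
  List.nodup_range.filter _

theorem length_rowCols_le (S : Finset (Fin p × Fin q)) (i : ℕ) : (rowCols S i).length ≤ q := by
  simpa [rowCols] using List.length_filter_le _ (List.range q)

theorem sum_length_rowCols_le (S : Finset (Fin p × Fin q)) :
    ∑ i ∈ Finset.range p, (rowCols S i).length ≤ S.card := by
  rw [Finset.card_eq_sum_card_fiberwise (f := fun z : Fin p × Fin q => (z.1 : ℕ))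
    (t := Finset.range p) fun z _ => by simp]
  refine Finset.sum_le_sum fun i _ => ?_
  rw [← List.toFinset_card_of_nodup (nodup_rowCols S i)]
  refine le_trans (Finset.card_le_card (t := (S.filter fun z => (z.1 : ℕ) = i).image
    fun z => (z.2 : ℕ)) fun j hj => ?_) Finset.card_image_le
  obtain ⟨z, hz, h1, h2⟩ := mem_rowCols.1 (List.mem_toFinset.1 hj)
  exact Finset.mem_image.2 ⟨z, Finset.mem_filter.2 ⟨hz, h1⟩, h2⟩

theorem sum_rowCols_nonzeros (M : Matrix (Fin p) (Fin q) F) (i : Fin p) (φ : ℕ → F) :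
    ((rowCols (nonzeros M) i).map fun j => extendZero M i j * φ j).sum =
      ∑ j : Fin q, M i j * φ j := by
  rw [← List.sum_toFinset _ (nodup_rowCols _ _),
    Finset.sum_subset (s₂ := Finset.range q) (fun j hj => ?_) (fun j hj hj' => ?_),
    Finset.sum_range]
  · exact Finset.sum_congr rfl fun j _ => by rw [extendZero_val]
  · obtain ⟨z, -, -, rfl⟩ := mem_rowCols.1 (List.mem_toFinset.1 hj)
    simp
  · have hq : j < q := by simpa using hj
    have : M i ⟨j, hq⟩ = 0 := by
      by_contra h
      exact hj' (List.mem_toFinset.2 (mem_rowCols.2 ⟨(i, ⟨j, hq⟩), by simpa [nonzeros], rfl, rfl⟩))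
    have h2 := extendZero_val M i ⟨j, hq⟩
    simp only at h2
    rw [h2, this, zero_mul]

end SparseRepresentation

/-! ### Correctness of the algorithm, and its cost as a sum over rows -/

section Algorithm

variable {F : Type u} [Field F]

theorem Spec.toSLP {ι κ : Type} {x : ι → F} {b : Build F ι (κ → Ref F ι)} {c : ℕ} {v : κ → F}
    (h : Spec [] b c fun code' o => ∀ k, Computes x code' (o k) (v k)) :
    b.toSLP.WellFormed ∧ (∀ k, b.toSLP.eval x k = v k) ∧ b.toSLP.cost ≤ c := by
  obtain ⟨-, h1, h2, h3⟩ := h codeOk_nil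
  exact ⟨⟨h2, fun k => (h3 k).1⟩, fun k => (h3 k).2, h1.trans (Nat.zero_add c).le⟩

/-- The cost of multiplying `A` by `B V`, where `V` has `N` columns and `SA` are the positions of
the nonzero entries of `A`. -/
def mulCost (mm : ∀ m : ℕ, SLP F ((Fin m × Fin m) ⊕ (Fin m × Fin m)) (Fin m × Fin m))
    (mode : MulMode) {r ℓ : ℕ} (N : ℕ) (SA : Finset (Fin r × Fin ℓ)) : ℕ :=
  match mode with
  | .sparse => ∑ i ∈ Finset.range r, N * ((rowCols SA i).length * 2)
  | .dense =>
    let m := blockSize r ℓ N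
    (r ⌈/⌉ m) * ((N ⌈/⌉ m) * ((ℓ ⌈/⌉ m) * ((mm m).cost + m * m)))

/-- The cost of the algorithm with the given way to multiply `A` by `B V`, when a power of `θ` costs
at most `2 h` operations, and applying the transposed Vandermonde procedure to a row with `t`
nonzero entries at most `K (t + 2 s)`. -/
def diffEvalCost (mm : ∀ m : ℕ, SLP F ((Fin m × Fin m) ⊕ (Fin m × Fin m)) (Fin m × Fin m))
    (mode : MulMode) (K h : ℕ) {r ℓ n : ℕ} (s : ℕ) (SA : Finset (Fin r × Fin ℓ))
    (SB : Finset (Fin ℓ × Fin n)) (SC : Finset (Fin r × Fin n)) : ℕ :=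
  n * (2 * h) +
    (∑ i ∈ Finset.range r, K * ((rowCols SC i).length + 2 * s) +
      (∑ k ∈ Finset.range ℓ, (if mode = .dense ∨ ∃ z ∈ SA, (z.2 : ℕ) = k then
          K * ((rowCols SB k).length + 2 * s) else 0) +
        (mulCost mm mode (2 * s) SA + r * (2 * s))))

variable [DecidableEq F]
variable {pm : ∀ d : ℕ, SLP F (Fin d ⊕ Fin d) (Fin (2 * d - 1))} {Λ D : ℕ}

/-- Row `i` of the product of `M` and the first `N` columns of the evaluation matrix. -/
def rowVal {p n : ℕ} (M : Matrix (Fin p) (Fin n) F) (θ : F) (N i t : ℕ) : F :=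
  if t < N then ((rowCols (nonzeros M) i).map fun j => extendZero M i j * (θ ^ j) ^ t).sum else 0

theorem rowVal_eq_mul_evalMatrix {p n s : ℕ} (M : Matrix (Fin p) (Fin n) F) (θ : F) (i : Fin p)
    (t : Fin (2 * s)) : rowVal M θ (2 * s) i t = (M * evalMatrix θ n s) i t := by
  rw [rowVal, if_pos t.2, sum_rowCols_nonzeros, Matrix.mul_apply]
  simp [evalMatrix, pow_mul]

theorem spec_rowVal (hpm : PolyMulSpec pm Λ D) {ι : Type} {x : ι → F} {code : List (Instr F ι)}
    {p n N h : ℕ} {M : Matrix (Fin p) (Fin n) F} {e : Fin p → Fin n → ι} {θ : F}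
    {pows : List (Ref F ι)} (i : ℕ) (he : ∀ i j, x (e i j) = M i j)
    (hpows : ∀ j ∈ rowCols (nonzeros M) i, Computes x code (pows.getD j (.const 0)) (θ ^ j))
    (hN : 2 * N ≤ D) (hn : n ≤ 2 ^ h) (hD : n ≤ D) :
    Spec code (transposedVandermonde pm N ((rowCols (nonzeros M) i).map fun j =>
        (sparseRef (nonzeros M) e i j, pows.getD j (.const 0))))
      ((9 * Λ + 8) * (h + 1) * ((rowCols (nonzeros M) i).length + N))
      fun code' y => ∀ j, Computes x code' (coeffRef y j) (rowVal M θ N i j) := by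
  have hlen := length_rowCols_le (nonzeros M) i
  have hrepr : ReprPairs x code ((rowCols (nonzeros M) i).map fun j =>
      (sparseRef (nonzeros M) e i j, pows.getD j (.const 0)))
      ((rowCols (nonzeros M) i).map fun j => (extendZero M i j, θ ^ j)) := by
    rw [ReprPairs, List.forall₂_map_left_iff, List.forall₂_map_right_iff, List.forall₂_same]
    exact fun j hj => ⟨reprMatrix_sparseRef he i j, hpows j hj⟩
  refine (spec_transposedVandermonde hpm hN hrepr (h := h) (by simp; omega) (by simp; omega)).mono
    (by simp) fun code' y _ hy j => ?_
  have := hy j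
  rwa [List.map_map] at this

omit [DecidableEq F] in
/-- The last step of the algorithm, the difference of `C V` and `A (B V)`. -/
theorem spec_subMatrix {ι : Type} {x : ι → F} {code : List (Instr F ι)} {r N : ℕ}
    {YC : List (List (Ref F ι))} {YAB : ℕ → ℕ → Ref F ι} {f g : ℕ → ℕ → F}
    (hC : ∀ i < r, ∀ d j, Computes x code (coeffRef (YC.getD i d) j) (f i j))
    (hAB : ∀ i < r, ∀ j < N, Computes x code (YAB i j) (g i j)) :
    Spec code (do
      let Y ← (List.range r).mapM fun i => (List.range N).mapM fun j =>
        emit .sub (coeffRef (YC.getD i []) j) (YAB i j)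
      return fun o : Fin r × Fin N => coeffRef (Y.getD o.1 []) o.2)
      (r * N) fun code' Y => ∀ o, Computes x code' (Y o) (f o.1 o.2 - g o.1 o.2) := by
  refine Spec.bind (c₁ := r * N) (c₂ := 0)
    ((Spec.mapM_range (c := fun _ => N) (R := fun i code' (row : List (Ref F ι)) =>
      ∀ j < N, ∀ d, Computes x code' (row.getD j d) (f i j - g i j))
      (fun i row c c' h h' j hj d => (h' j hj d).mono h) fun i hi code₁ g₁ => ?_).mono
      (by simp) fun _ _ _ h => h.2) ?_
  · refine (Spec.mapM_range (c := fun _ => 1) (R := fun j code' y =>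
      Computes x code' y (f i j - g i j)) (fun _ _ _ _ h h' => h'.mono h)
      fun j hj code₂ g₂ => ?_).mono (by simp) fun _ _ _ h => h.2
    exact spec_emit .sub ((hC i hi [] j).mono (g₁.trans g₂)) ((hAB i hi j hj).mono (g₁.trans g₂))
  · exact fun code₁ Y _ h => Spec.pure fun o => h o.1 o.1.2 [] o.2 o.2.2 _

variable {mm : ∀ m : ℕ, SLP F ((Fin m × Fin m) ⊕ (Fin m × Fin m)) (Fin m × Fin m)}

/-- With either way to multiply `A` by `B V`, the algorithm computes `(C - A B) V`. -/
theorem spec_diffEvalBuild (hpm : PolyMulSpec pm Λ D) (hw : ∀ m, (mm m).WellFormed)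
    (he : ∀ m, ∀ X Y : Matrix (Fin m) (Fin m) F, ∀ i j : Fin m,
      (mm m).eval (Sum.elim (fun p => X p.1 p.2) (fun p => Y p.1 p.2)) (i, j) = (X * Y) i j)
    (mode : MulMode) {r ℓ n s h : ℕ} (A : Matrix (Fin r) (Fin ℓ) F) (B : Matrix (Fin ℓ) (Fin n) F)
    (C : Matrix (Fin r) (Fin n) F) (θ : F) (hs : 2 * (2 * s) ≤ D) (hn : n ≤ 2 ^ h) (hD : n ≤ D) :
    Spec [] (diffEvalBuild pm mm mode s (nonzeros A) (nonzeros B) (nonzeros C))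
      (diffEvalCost mm mode ((9 * Λ + 8) * (h + 1)) h s (nonzeros A) (nonzeros B) (nonzeros C))
      fun code' Y => ∀ o, Computes (diffEvalInput A B C θ) code' (Y o)
        (((C - A * B) * evalMatrix θ n s) o.1 o.2) := by
  set x := diffEvalInput A B C θ with hx
  unfold diffEvalBuild diffEvalCost
  refine Spec.bind (c₁ := n * (2 * h)) ((Spec.mapM_range (c := fun _ => 2 * h)
    (R := fun j code' y => ((∃ z ∈ nonzeros B, (z.2 : ℕ) = j) ∨ ∃ z ∈ nonzeros C, (z.2 : ℕ) = j) →
      Computes x code' y (θ ^ j)) (fun _ _ _ _ h h' hj => (h' hj).mono h)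
    fun j hj code₁ _ => ?_).mono (by simp) fun _ _ _ h => h) ?_
  · split_ifs with hc
    · exact (spec_powRef h j code₁ (computes_inp x code₁ .theta) (by omega)).mono le_rfl
        fun _ _ _ h _ => h
    · exact (Spec.pure fun h => absurd h hc).mono (Nat.zero_le _) fun _ _ _ h => h
  rintro code₁ pows - ⟨-, hpows⟩
  refine Spec.bind (Spec.mapM_range
    (c := fun i => (9 * Λ + 8) * (h + 1) * ((rowCols (nonzeros C) i).length + 2 * s))
    (R := fun i code' y => ∀ j, Computes x code' (coeffRef y j) (rowVal C θ (2 * s) i j))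
    (fun _ _ _ _ h h' j => (h' j).mono h) fun i _ code₂ g₂ => ?_) ?_
  · refine spec_rowVal hpm i (fun i j => rfl) (fun j hj => ?_) hs hn hD
    obtain ⟨z, hz, -, rfl⟩ := mem_rowCols.1 hj
    exact (hpows _ z.2.2 _ (Or.inr ⟨z, hz, rfl⟩)).mono g₂
  rintro code₂ YC g₂ ⟨-, hYC⟩
  -- the rows of `B V` that are not needed are left out, that is, replaced by `0`
  set gB : ℕ → ℕ → F := fun k j => if mode = .dense ∨ ∃ z ∈ nonzeros A, (z.2 : ℕ) = k then
    rowVal B θ (2 * s) k j else 0 with hgB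
  refine Spec.bind (Spec.mapM_range
    (c := fun k => if mode = .dense ∨ ∃ z ∈ nonzeros A, (z.2 : ℕ) = k then
      (9 * Λ + 8) * (h + 1) * ((rowCols (nonzeros B) k).length + 2 * s) else 0)
    (R := fun k code' y => ∀ j, Computes x code' (coeffRef y j) (gB k j))
    (fun _ _ _ _ h h' j => (h' j).mono h) fun k _ code₃ g₃ => ?_) ?_
  · by_cases hk : mode = .dense ∨ ∃ z ∈ nonzeros A, (z.2 : ℕ) = k
    · simp only [hgB, if_pos hk]
      refine spec_rowVal hpm k (fun i j => rfl) (fun j hj => ?_) hs hn hD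
      obtain ⟨z, hz, -, rfl⟩ := mem_rowCols.1 hj
      exact (hpows _ z.2.2 _ (Or.inl ⟨z, hz, rfl⟩)).mono (g₂.trans g₃)
    · simp only [hgB, if_neg hk]
      exact Spec.pure fun j => by simpa [coeffRef] using computes_const x code₃ (0 : F)
  rintro code₃ YB g₃ ⟨hlen, hYB⟩
  have hmatYB : ReprMatrix x code₃ (fun k j => coeffRef (YB.getD k []) j)
      fun k j => if k < ℓ then gB k j else 0 := by
    intro k j
    simp only
    split_ifs with hk
    · exact hYB k hk _ j
    · rw [List.getD_eq_default _ _ (by omega)]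
      simpa [coeffRef] using computes_const x code₃ (0 : F)
  have hmatA : ReprMatrix x code₃ (sparseRef (nonzeros A) .a) (extendZero A) :=
    reprMatrix_sparseRef fun _ _ => rfl
  have hres : ∀ o : Fin r × Fin (2 * s), rowVal C θ (2 * s) o.1 o.2 -
      (if hi : (o.1 : ℕ) < r then ∑ k : Fin ℓ, A ⟨o.1, hi⟩ k * gB k o.2 else 0) =
      ((C - A * B) * evalMatrix θ n s) o.1 o.2 := by
    intro o
    rw [dif_pos o.1.2, rowVal_eq_mul_evalMatrix, Matrix.sub_mul, Matrix.mul_assoc, Matrix.sub_apply,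
      Matrix.mul_apply (M := A)]
    congr 1
    refine Finset.sum_congr rfl fun k _ => ?_
    by_cases hA : A o.1 k = 0
    · simp [hA]
    · have hk : mode = .dense ∨ ∃ z ∈ nonzeros A, (z.2 : ℕ) = k :=
        Or.inr ⟨(o.1, k), by simpa [nonzeros], rfl⟩
      simp only [hgB, if_pos hk]
      rw [rowVal_eq_mul_evalMatrix]
  have htail : ∀ (code₄ : List (Instr F (DiffEvalInput r ℓ n)))
      (YAB : ℕ → ℕ → Ref F (DiffEvalInput r ℓ n)), code₃ <+: code₄ →
      (∀ i : Fin r, ∀ j < 2 * s,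
        Computes x code₄ (YAB i j) (∑ k : Fin ℓ, A i k * gB k j)) → _ :=
    fun code₄ YAB g₄ hYAB => (spec_subMatrix (N := 2 * s)
      (g := fun i j => if hi : i < r then ∑ k : Fin ℓ, A ⟨i, hi⟩ k * gB k j else 0)
      (fun i hi d j => (hYC i hi d j).mono (g₃.trans g₄)) fun i hi j hj => by
        simpa only [dif_pos hi] using hYAB ⟨i, hi⟩ j hj).mono le_rfl
      fun _ Y _ hY o => (hres o) ▸ hY o
  cases mode with
  | sparse =>
    refine Spec.bind (spec_sparseMul hmatA hmatYB) fun code₄ YAB g₄ hYAB => htail _ _ g₄ ?_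
    intro i j hj
    have := hYAB i i.2 j hj
    rw [sum_rowCols_nonzeros] at this
    simpa using this
  | dense =>
    refine Spec.bind (spec_denseMul hw he rfl hmatA hmatYB fun i k hk => ?_)
      fun code₄ YAB g₄ hYAB => htail _ _ g₄ ?_
    · exact dif_neg (by omega)
    · intro i j hj
      have := hYAB i i.2 j hj
      rw [Finset.sum_range] at this
      simpa [extendZero_val] using this

end Algorithm

/-! ### Bounds in terms of the numbers of nonzero entries -/

section CostBounds

variable {F : Type u}

theorem sum_rowCost_le {p q : ℕ} (K N : ℕ) (S : Finset (Fin p × Fin q)) :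
    ∑ i ∈ Finset.range p, K * ((rowCols S i).length + N) ≤ K * (S.card + p * N) := by
  rw [← Finset.mul_sum, Finset.sum_add_distrib, Finset.sum_const, Finset.card_range, smul_eq_mul]
  exact Nat.mul_le_mul_left _ (Nat.add_le_add_right (sum_length_rowCols_le S) _)

variable (mm : ∀ m : ℕ, SLP F ((Fin m × Fin m) ⊕ (Fin m × Fin m)) (Fin m × Fin m))
  {r ℓ n : ℕ} (SA : Finset (Fin r × Fin ℓ)) (SB : Finset (Fin ℓ × Fin n))
  (SC : Finset (Fin r × Fin n))

/-- Without rows there is nothing to do but to compute powers of `θ`. -/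
theorem diffEvalCost_sparse_of_no_rows (K h s : ℕ) (hr : r = 0) :
    diffEvalCost mm .sparse K h s SA SB SC = n * (2 * h) := by
  subst hr
  have : ∀ k : ℕ, ¬∃ z ∈ SA, (z.2 : ℕ) = k := fun k ⟨z, _, _⟩ => z.1.elim0
  simp [diffEvalCost, mulCost]

/-- At most `#A` rows of `B V` are multiplied by a nonzero entry of `A`. -/
theorem diffEvalCost_sparse_le {K h : ℕ} (s : ℕ) (hh : h + 1 ≤ K) :
    diffEvalCost mm .sparse K h s SA SB SC ≤
      6 * K * (SB.card + SC.card + n + s * (SA.card + r)) := by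
  have h1 : n * (2 * h) ≤ n * (2 * K) := Nat.mul_le_mul_left _ (by omega)
  have h2 := sum_rowCost_le K (2 * s) SC
  have h3 : ∑ k ∈ Finset.range ℓ,
      (if MulMode.sparse = .dense ∨ ∃ z ∈ SA, (z.2 : ℕ) = k then
        K * ((rowCols SB k).length + 2 * s) else 0) ≤ K * (SB.card + SA.card * (2 * s)) := by
    calc _ ≤ ∑ k ∈ Finset.range ℓ, (K * (rowCols SB k).length +
          (if k ∈ SA.image (fun z => (z.2 : ℕ)) then K * (2 * s) else 0)) := by
          refine Finset.sum_le_sum fun k _ => ?_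
          simp only [reduceCtorEq, false_or, Finset.mem_image]
          split_ifs
          · exact le_of_eq (mul_add _ _ _)
          · exact Nat.zero_le _
      _ ≤ K * SB.card + SA.card * (K * (2 * s)) := by
          rw [Finset.sum_add_distrib, ← Finset.mul_sum, ← Finset.sum_filter, Finset.sum_const,
            smul_eq_mul]
          refine add_le_add (Nat.mul_le_mul_left _ (sum_length_rowCols_le SB))
            (Nat.mul_le_mul_right _ (le_trans (Finset.card_le_card fun k hk => ?_)
              (Finset.card_image_le (s := SA) (f := fun z => (z.2 : ℕ)))))
          exact (Finset.mem_filter.1 hk).2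
      _ = _ := by ring
  have h4 : mulCost mm .sparse (2 * s) SA ≤ 4 * (s * SA.card) := by
    calc mulCost mm .sparse (2 * s) SA
        = 4 * (s * ∑ i ∈ Finset.range r, (rowCols SA i).length) := by
          simp only [mulCost, Finset.mul_sum]
          exact Finset.sum_congr rfl fun i _ => by ring
      _ ≤ _ := Nat.mul_le_mul_left _ (Nat.mul_le_mul_left _ (sum_length_rowCols_le SA))
  have h5 : 4 * (s * SA.card) ≤ K * (4 * (s * SA.card)) := Nat.le_mul_of_pos_left _ (by omega)
  have h6 : 2 * (r * s) ≤ K * (2 * (r * s)) := Nat.le_mul_of_pos_left _ (by omega)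
  unfold diffEvalCost
  calc _ ≤ n * (2 * K) + (K * (SC.card + r * (2 * s)) + (K * (SB.card + SA.card * (2 * s)) +
        (K * (4 * (s * SA.card)) + K * (2 * (r * s))))) := by
        rw [show r * (2 * s) = 2 * (r * s) by ring] at h2 ⊢
        omega
    _ ≤ n * (2 * K) + (K * (SC.card + r * (2 * s)) + (K * (SB.card + SA.card * (2 * s)) +
        (K * (4 * (s * SA.card)) + K * (2 * (r * s))))) +
        (4 * n * K + 5 * K * SC.card + 5 * K * SB.card + 2 * K * r * s) := Nat.le_add_right _ _
    _ = _ := by ring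

theorem diffEvalCost_dense_le {K h : ℕ} (s : ℕ) (hh : h + 1 ≤ K) :
    diffEvalCost mm .dense K h s SA SB SC ≤
      6 * K * (SB.card + SC.card + n + s * r + s * ℓ) + mulCost mm .dense (2 * s) SA := by
  have h1 : n * (2 * h) ≤ n * (2 * K) := Nat.mul_le_mul_left _ (by omega)
  have h2 := sum_rowCost_le K (2 * s) SC
  have h3 := sum_rowCost_le K (2 * s) SB
  have h6 : 2 * (r * s) ≤ K * (2 * (r * s)) := Nat.le_mul_of_pos_left _ (by omega)
  unfold diffEvalCost
  simp only [true_or, if_true]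
  calc _ ≤ n * (2 * K) + (K * (SC.card + r * (2 * s)) + (K * (SB.card + ℓ * (2 * s)) +
        (mulCost mm .dense (2 * s) SA + K * (2 * (r * s))))) := by
        rw [show r * (2 * s) = 2 * (r * s) by ring] at h2 ⊢
        omega
    _ ≤ n * (2 * K) + (K * (SC.card + r * (2 * s)) + (K * (SB.card + ℓ * (2 * s)) +
        (mulCost mm .dense (2 * s) SA + K * (2 * (r * s))))) +
        (4 * n * K + 5 * K * SC.card + 5 * K * SB.card + 2 * K * r * s + 4 * K * ℓ * s) :=
        Nat.le_add_right _ _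
    _ = _ := by ring

theorem mul_ceilDiv_le {a m : ℕ} (hm : 0 < m) (h : m ≤ a) : m * (a ⌈/⌉ m) ≤ 2 * a := by
  rw [Nat.ceilDiv_eq_add_pred_div]
  exact (Nat.mul_div_le _ _).trans (by omega)

/-- For `1 ≤ s`, the number of block products is at most `8 r (2 s) ℓ / m ^ 3` for blocks of
size `m`, which is at least `min r (min s ℓ)`. -/
theorem mulCost_dense_le {ω c : ℝ} (hω : 2 ≤ ω ∧ ω ≤ 3) (hc : 0 ≤ c)
    (hmm : ∀ m, ((mm m).cost : ℝ) ≤ c * (m : ℝ) ^ ω) (hr : 0 < r) (hl : 0 < ℓ) (s : ℕ) :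
    (mulCost mm .dense (2 * s) SA : ℝ) ≤
      16 * (c + 1) * (s * (r * ℓ / ((min r (min s ℓ) : ℕ) : ℝ) ^ (3 - ω))) := by
  rcases Nat.eq_zero_or_pos s with rfl | hs
  · simp [mulCost]
  set m := blockSize r ℓ (2 * s) with hm
  rw [blockSize] at hm
  have hm0 : 0 < m := by omega
  have hmin : 0 < min r (min s ℓ) := by omega
  have hmR : (0 : ℝ) < m := by exact_mod_cast hm0
  have hminR : (0 : ℝ) < (min r (min s ℓ) : ℕ) := by exact_mod_cast hmin
  set a := r ⌈/⌉ m
  set b := 2 * s ⌈/⌉ m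
  set d := ℓ ⌈/⌉ m
  have hblocks : m ^ 3 * (a * (b * d)) ≤ 16 * (r * s * ℓ) := by
    have h1 := mul_ceilDiv_le (a := r) hm0 (by omega)
    have h2 := mul_ceilDiv_le (a := 2 * s) hm0 (by omega)
    have h3 := mul_ceilDiv_le (a := ℓ) hm0 (by omega)
    calc m ^ 3 * (a * (b * d)) = (m * a) * ((m * b) * (m * d)) := by ring
      _ ≤ (2 * r) * ((2 * (2 * s)) * (2 * ℓ)) := by gcongr
      _ = _ := by ring
  have hblocksR : (m : ℝ) ^ 3 * (a * (b * d)) ≤ 16 * (r * s * ℓ) := by exact_mod_cast hblocks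
  have hsq : (m : ℝ) * m ≤ (m : ℝ) ^ ω := by
    rw [← pow_two, ← Real.rpow_natCast]
    exact Real.rpow_le_rpow_of_exponent_le (by exact_mod_cast hm0) (by simpa using hω.1)
  have hpow : (m : ℝ) ^ ω = (m : ℝ) ^ 3 / (m : ℝ) ^ (3 - ω) := by
    rw [← Real.rpow_natCast, ← Real.rpow_sub hmR]
    congr 1
    push_cast
    ring
  have hmono : ((min r (min s ℓ) : ℕ) : ℝ) ^ (3 - ω) ≤ (m : ℝ) ^ (3 - ω) :=
    Real.rpow_le_rpow hminR.le (by exact_mod_cast (by omega : min r (min s ℓ) ≤ m))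
      (by linarith [hω.2])
  have hE : (0 : ℝ) < ((min r (min s ℓ) : ℕ) : ℝ) ^ (3 - ω) := Real.rpow_pos_of_pos hminR _
  have hE' : (0 : ℝ) < (m : ℝ) ^ (3 - ω) := Real.rpow_pos_of_pos hmR _
  calc (mulCost mm .dense (2 * s) SA : ℝ)
      = (a * (b * d)) * ((mm m).cost + m * m) := by
        show ((a * (b * (d * ((mm m).cost + m * m))) : ℕ) : ℝ) = _
        push_cast
        ring
    _ ≤ (a * (b * d)) * (c * (m : ℝ) ^ ω + (m : ℝ) ^ ω) := by
        gcongr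
        exact hmm m
    _ = (c + 1) * ((m : ℝ) ^ 3 * (a * (b * d)) / (m : ℝ) ^ (3 - ω)) := by rw [hpow]; ring
    _ ≤ (c + 1) * (16 * (r * s * ℓ) / ((min r (min s ℓ) : ℕ) : ℝ) ^ (3 - ω)) := by gcongr
    _ = _ := by ring

/-- If `1 ≤ r, s, ℓ`, both `r` and `ℓ` are at most `r ℓ / min(r, s, ℓ) ^ (3 - ω)`. -/
theorem max_le_mul_div_rpow {ω : ℝ} (hω : 2 ≤ ω ∧ ω ≤ 3) {s : ℕ} (hr : 0 < r) (hl : 0 < ℓ)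
    (hs : 0 < s) : max (r : ℝ) ℓ ≤ r * ℓ / ((min r (min s ℓ) : ℕ) : ℝ) ^ (3 - ω) := by
  have hmin : 1 ≤ min r (min s ℓ) := by omega
  have h1 : (1 : ℝ) ≤ (min r (min s ℓ) : ℕ) := by exact_mod_cast hmin
  have hE : (0 : ℝ) < ((min r (min s ℓ) : ℕ) : ℝ) ^ (3 - ω) := Real.rpow_pos_of_pos (by linarith) _
  have hle : ((min r (min s ℓ) : ℕ) : ℝ) ^ (3 - ω) ≤ (min r (min s ℓ) : ℕ) := by
    conv_rhs => rw [← Real.rpow_one ((min r (min s ℓ) : ℕ) : ℝ)]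
    exact Real.rpow_le_rpow_of_exponent_le h1 (by linarith [hω.1])
  have h2 : ((min r (min s ℓ) : ℕ) : ℝ) ≤ r := by exact_mod_cast min_le_left _ _
  have h3 : ((min r (min s ℓ) : ℕ) : ℝ) ≤ ℓ := by
    exact_mod_cast (min_le_right _ _).trans (min_le_right _ _)
  rw [max_le_iff, le_div_iff₀ hE, le_div_iff₀ hE]
  constructor
  · gcongr
    linarith
  · rw [mul_comm]
    gcongr
    linarith

end CostBounds

/-! ### Soft-oh bounds -/

theorem dense_total_le {t u v q K c : ℝ} (ht : 0 ≤ t) (hq : 0 ≤ q) (hu : u ≤ q) (hv : v ≤ q)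
    (hK : 1 ≤ K) (hc : 0 ≤ c) : 6 * K * (t + u + v) + c * q ≤ (12 + c) * K * (t + q) := by
  have h1 : q ≤ K * (t + q) :=
    (le_add_of_nonneg_left ht).trans (le_mul_of_one_le_left (add_nonneg ht hq) hK)
  calc 6 * K * (t + u + v) + c * q ≤ 6 * K * (2 * (t + q)) + c * (K * (t + q)) :=
        add_le_add (mul_le_mul_of_nonneg_left (by linarith) (by linarith))
          (mul_le_mul_of_nonneg_left h1 hc)
    _ = _ := by ring

/-- Of the two ways to multiply, the better one attains the minimum in the cost bound. -/
theorem le_of_le_diffEvalCost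
    {F : Type u} {mm : ∀ m : ℕ, SLP F ((Fin m × Fin m) ⊕ (Fin m × Fin m)) (Fin m × Fin m)}
    {r ℓ n : ℕ} (SA : Finset (Fin r × Fin ℓ)) (SB : Finset (Fin ℓ × Fin n))
    (SC : Finset (Fin r × Fin n)) {ω c : ℝ} (hω : 2 ≤ ω ∧ ω ≤ 3) (hc : 0 ≤ c)
    (hmm : ∀ m, ((mm m).cost : ℝ) ≤ c * (m : ℝ) ^ ω) (hr : 0 < r) (hl : 0 < ℓ) {K h : ℕ} (s : ℕ)
    (hh : h + 1 ≤ K) {p : ℕ} (hp : ∀ mode, p ≤ diffEvalCost mm mode K h s SA SB SC) :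
    (p : ℝ) ≤ (12 + 16 * (c + 1)) * K * (SB.card + SC.card + n + s * min (SA.card + r : ℝ)
      (r * ℓ / ((min r (min s ℓ) : ℕ) : ℝ) ^ (3 - ω))) := by
  have h2 := mulCost_dense_le mm SA hω hc hmm hr hl s
  have hmax : (s : ℝ) * max (r : ℝ) ℓ ≤ s * (r * ℓ / ((min r (min s ℓ) : ℕ) : ℝ) ^ (3 - ω)) := by
    rcases Nat.eq_zero_or_pos s with rfl | hs
    · simp
    · exact mul_le_mul_of_nonneg_left (max_le_mul_div_rpow hω hr hl hs) (Nat.cast_nonneg _)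
  generalize (r * ℓ / ((min r (min s ℓ) : ℕ) : ℝ) ^ (3 - ω) : ℝ) = μ at *
  have hs0 : (0 : ℝ) ≤ s := Nat.cast_nonneg _
  have hK : (1 : ℝ) ≤ K := by exact_mod_cast (by omega : 1 ≤ K)
  have hu : (s : ℝ) * r ≤ s * μ := (mul_le_mul_of_nonneg_left (le_max_left _ _) hs0).trans hmax
  have hv : (s : ℝ) * ℓ ≤ s * μ := (mul_le_mul_of_nonneg_left (le_max_right _ _) hs0).trans hmax
  have hsμ : 0 ≤ s * μ := (mul_nonneg hs0 (Nat.cast_nonneg _)).trans hu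
  rcases le_total (SA.card + r : ℝ) μ with hle | hle
  · have h1 : (p : ℝ) ≤ 6 * K * (SB.card + SC.card + n + s * (SA.card + r)) := by
      exact_mod_cast (hp .sparse).trans (diffEvalCost_sparse_le mm SA SB SC s hh)
    rw [min_eq_left hle]
    refine h1.trans ?_
    gcongr
    linarith
  · have h1 : (p : ℝ) ≤ 6 * K * (SB.card + SC.card + n + s * r + s * ℓ) +
        mulCost mm .dense (2 * s) SA := by
      exact_mod_cast (hp .dense).trans (diffEvalCost_dense_le mm SA SB SC s hh)
    rw [min_eq_right hle]
    exact (h1.trans (add_le_add le_rfl h2)).trans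
      (dense_total_le (by positivity) hsμ hu hv hK (by positivity))

/-- The term `s * min(…)` is at least `s`, so that `s` is bounded by the size in the soft-oh
bound. -/
theorem le_mul_min_cost {ω : ℝ} (hω : 2 ≤ ω ∧ ω ≤ 3) {r ℓ : ℕ} (hr : 0 < r) (hl : 0 < ℓ) (s a : ℕ) :
    (s : ℝ) ≤ s * min (a + r : ℝ) (r * ℓ / ((min r (min s ℓ) : ℕ) : ℝ) ^ (3 - ω)) := by
  rcases Nat.eq_zero_or_pos s with rfl | hs
  · simp
  have hr1 : (1 : ℝ) ≤ r := by exact_mod_cast hr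
  have ha : (0 : ℝ) ≤ a := Nat.cast_nonneg _
  exact le_mul_of_one_le_right (Nat.cast_nonneg _) (le_min (by linarith)
    (hr1.trans ((le_max_left _ _).trans (max_le_mul_div_rpow hω hr hl hs))))

theorem one_le_logb_add_two {g : ℝ} (hg : 0 ≤ g) : 1 ≤ Real.logb 2 (g + 2) := by
  rw [Real.le_logb_iff_rpow_le (by norm_num) (by linarith)]
  simpa using hg

/-- A logarithmic factor for sizes at most `4 g` is one for `g`. -/
theorem logb_add_two_le {D g : ℝ} (hg : 0 ≤ g) (hD0 : 0 ≤ D) (hD : D ≤ 4 * g) :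
    Real.logb 2 (D + 2) ≤ 3 * Real.logb 2 (g + 2) := by
  have h1 := one_le_logb_add_two hg
  calc Real.logb 2 (D + 2) ≤ Real.logb 2 (2 ^ 2 * (g + 2)) :=
        Real.logb_le_logb_of_le (by norm_num) (by linarith) (by linarith)
    _ = 2 + Real.logb 2 (g + 2) := by
        rw [Real.logb_mul (by norm_num) (by linarith), Real.logb_pow, Real.logb_self_eq_one]
        · norm_num
        · norm_num
    _ ≤ _ := by linarith

section SoftOh

variable {F : Type u} [Field F]

/-- For lengths up to `D`, the logarithmic factor in the cost of the multiplication routine can be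
replaced by its value at `D`. -/
theorem IsPolyMulFamily.polyMulSpec {c : ℝ} {k : ℕ}
    {pm : ∀ d : ℕ, SLP F (Fin d ⊕ Fin d) (Fin (2 * d - 1))} (h : IsPolyMulFamily c k pm) (D : ℕ) :
    PolyMulSpec pm ⌈max c 0 * Real.logb 2 (D + 2) ^ k⌉₊ D := by
  refine fun d => ⟨(h d).1, (h d).2.1, fun hd => ?_⟩
  have hdD : (d : ℝ) ≤ D := by exact_mod_cast hd
  have hlog := one_le_logb_add_two (Nat.cast_nonneg (α := ℝ) d)
  have hc : ((pm d).cost : ℝ) ≤ (max c 0 * Real.logb 2 (D + 2) ^ k) * d := by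
    refine (h d).2.2.trans ?_
    calc softBound c k d ≤ max c 0 * d * Real.logb 2 (d + 2) ^ k := by
          unfold softBound
          gcongr
          exact le_max_left _ _
      _ ≤ max c 0 * d * Real.logb 2 (D + 2) ^ k := by
          gcongr
          norm_num
      _ = _ := by ring
  have : ((pm d).cost : ℝ) ≤ (⌈max c 0 * Real.logb 2 (D + 2) ^ k⌉₊ : ℝ) * d :=
    hc.trans (mul_le_mul_of_nonneg_right (Nat.le_ceil _) (Nat.cast_nonneg _))
  exact_mod_cast this

theorem natLog_add_two_le {n : ℕ} {g : ℝ} (hn : (n : ℝ) ≤ g) :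
    ((Nat.log 2 n + 1 : ℕ) : ℝ) + 1 ≤ 3 * Real.logb 2 (g + 2) := by
  have hg : 0 ≤ g := (Nat.cast_nonneg n).trans hn
  have h1 := one_le_logb_add_two hg
  have h2 : (Nat.log 2 n : ℝ) ≤ Real.logb 2 (g + 2) := by
    rcases Nat.eq_zero_or_pos n with rfl | hn0
    · simp only [Nat.log_zero_right, Nat.cast_zero]
      linarith
    · have hn' : (0 : ℝ) < n := by exact_mod_cast hn0
      refine (Real.natLog_le_logb n 2).trans ?_
      exact Real.logb_le_logb_of_le (by norm_num) hn' (by linarith)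
  push_cast
  linarith

/-- The factor `K` in the cost of applying the transposed evaluation matrix to a row is
polylogarithmic. -/
theorem rowFactor_le {c : ℝ} (hc : 0 ≤ c) (k : ℕ) {n D : ℕ} {g : ℝ} (hn : (n : ℝ) ≤ g)
    (hD : (D : ℝ) ≤ 4 * g) :
    (((9 * ⌈c * Real.logb 2 (D + 2) ^ k⌉₊ + 8) * ((Nat.log 2 n + 1) + 1) : ℕ) : ℝ) ≤
      3 * (9 * (c * 3 ^ k + 1) + 8) * Real.logb 2 (g + 2) ^ (k + 1) := by
  have hg : 0 ≤ g := (Nat.cast_nonneg n).trans hn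
  have h1 := one_le_logb_add_two hg
  have h2 := natLog_add_two_le hn
  have h3 := logb_add_two_le hg (Nat.cast_nonneg D) hD
  have h4 := one_le_logb_add_two (Nat.cast_nonneg (α := ℝ) D)
  set L := Real.logb 2 (g + 2)
  have hLk : 1 ≤ L ^ k := one_le_pow₀ h1
  have h5 : (⌈c * Real.logb 2 (D + 2) ^ k⌉₊ : ℝ) ≤ (c * 3 ^ k + 1) * L ^ k := by
    have h6 : c * Real.logb 2 (D + 2) ^ k ≤ c * (3 * L) ^ k := by gcongr
    have h7 := (Nat.ceil_lt_add_one (a := c * Real.logb 2 (D + 2) ^ k) (by positivity)).le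
    rw [mul_pow] at h6
    linarith
  have h8 : (9 * (⌈c * Real.logb 2 (D + 2) ^ k⌉₊ : ℝ) + 8) ≤ (9 * (c * 3 ^ k + 1) + 8) * L ^ k := by
    linarith
  calc _ = (9 * (⌈c * Real.logb 2 (D + 2) ^ k⌉₊ : ℝ) + 8) *
        (((Nat.log 2 n + 1 : ℕ) : ℝ) + 1) := by push_cast; ring
    _ ≤ ((9 * (c * 3 ^ k + 1) + 8) * L ^ k) * (3 * L) := by gcongr
    _ = _ := by ring

/-- The chosen program is one of the two, and not more expensive than either. -/
theorem diffEval_eq_or {pm : ∀ d : ℕ, SLP F (Fin d ⊕ Fin d) (Fin (2 * d - 1))}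
    {mm : ∀ m : ℕ, SLP F ((Fin m × Fin m) ⊕ (Fin m × Fin m)) (Fin m × Fin m)}
    {r ℓ n : ℕ} (s : ℕ) (SA : Finset (Fin r × Fin ℓ)) (SB : Finset (Fin ℓ × Fin n))
    (SC : Finset (Fin r × Fin n)) :
    (∃ mode, diffEval pm mm s SA SB SC = (diffEvalBuild pm mm mode s SA SB SC).toSLP) ∧
      ∀ mode, (diffEval pm mm s SA SB SC).cost ≤
        (diffEvalBuild pm mm mode s SA SB SC).toSLP.cost := by
  unfold diffEval
  dsimp only
  split_ifs with h
  · exact ⟨⟨.sparse, rfl⟩, fun mode => by cases mode; exacts [le_rfl, h]⟩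
  · exact ⟨⟨.dense, rfl⟩, fun mode => by cases mode; exacts [(not_le.1 h).le, le_rfl]⟩

end SoftOh

end MatEC

theorem mainTheorem5 (ω : ℝ) (hω : 2 ≤ ω ∧ ω ≤ 3) (cM cP : ℝ) (kP : ℕ) :
    ∃ (c : ℝ) (k : ℕ),
      ∀ (F : Type*) [Field F] [DecidableEq F]
        (pm : ∀ d : ℕ, MatEC.SLP F (Fin d ⊕ Fin d) (Fin (2 * d - 1)))
        (mm : ∀ m : ℕ, MatEC.SLP F ((Fin m × Fin m) ⊕ (Fin m × Fin m)) (Fin m × Fin m)),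
        MatEC.IsPolyMulFamily cP kP pm → MatEC.IsMatMulFamily ω cM mm →
        ∀ (r ℓ n s : ℕ) (A : Matrix (Fin r) (Fin ℓ) F) (B : Matrix (Fin ℓ) (Fin n) F)
          (C : Matrix (Fin r) (Fin n) F) (P : MatEC.SLP F (MatEC.DiffEvalInput r ℓ n)
            (Fin r × Fin (2 * s))),
          P = MatEC.diffEval pm mm s (MatEC.nonzeros A) (MatEC.nonzeros B) (MatEC.nonzeros C) →
          P.WellFormed ∧
          (∀ (θ : F) (i : Fin r) (j : Fin (2 * s)),
            P.eval (MatEC.diffEvalInput A B C θ) (i, j) =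
              ((C - A * B) * MatEC.evalMatrix θ n s) i j) ∧
          (0 < ℓ →
            (P.cost : ℝ) ≤ MatEC.softBound c k
              ((MatEC.nonzeros B).card + (MatEC.nonzeros C).card + n +
                s * min ((MatEC.nonzeros A).card + r : ℝ)
                  (r * ℓ / ((min r (min s ℓ) : ℕ) : ℝ) ^ (3 - ω)))) := by
  set c₁ : ℝ := 3 * (9 * (max cP 0 * 3 ^ kP + 1) + 8) with hc₁
  set c₂ : ℝ := 16 * (max cM 0 + 1) with hc₂
  have hc₁1 : 1 ≤ c₁ := by
    have : 0 ≤ max cP 0 * 3 ^ kP := by positivity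
    linarith
  have hc₂0 : 0 ≤ c₂ := by positivity
  refine ⟨(12 + c₂) * c₁, kP + 1, ?_⟩
  intro F _ _ pm mm hpm hmm r ℓ n s A B C P hP
  -- bound for the lengths of all polynomials that are multiplied
  set D : ℕ := max n (4 * s) with hD
  set Λ : ℕ := ⌈max cP 0 * Real.logb 2 (D + 2) ^ kP⌉₊ with hΛ
  set h : ℕ := Nat.log 2 n + 1 with hh
  set K : ℕ := (9 * Λ + 8) * (h + 1) with hK
  have hspec := fun mode θ => (MatEC.spec_diffEvalBuild (hpm.polyMulSpec D) (fun m => (hmm m).1)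
    (fun m => (hmm m).2.1) mode A B C θ (s := s) (h := h) (by omega)
    (Nat.lt_pow_succ_log_self (by norm_num) n).le (by omega)).toSLP
  rw [← hΛ, ← hK] at hspec
  obtain ⟨⟨mode, hmode⟩, hmin⟩ := MatEC.diffEval_eq_or (pm := pm) (mm := mm) s (MatEC.nonzeros A)
    (MatEC.nonzeros B) (MatEC.nonzeros C)
  rw [← hP] at hmode hmin
  refine ⟨hmode ▸ (hspec mode 0).1, fun θ i j => hmode ▸ (hspec mode θ).2.1 (i, j), fun hl => ?_⟩
  have hmmc : ∀ m, ((mm m).cost : ℝ) ≤ max cM 0 * (m : ℝ) ^ ω := fun m =>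
    (hmm m).2.2.trans (mul_le_mul_of_nonneg_right (le_max_left _ _) (by positivity))
  have hcost := fun mode => (hmin mode).trans (hspec mode 0).2.2
  set nA : ℕ := (MatEC.nonzeros A).card
  set nB : ℕ := (MatEC.nonzeros B).card
  set nC : ℕ := (MatEC.nonzeros C).card
  set μ : ℝ := r * ℓ / ((min r (min s ℓ) : ℕ) : ℝ) ^ (3 - ω) with hμ
  have hμ0 : 0 ≤ μ :=
    div_nonneg (mul_nonneg (Nat.cast_nonneg _) (Nat.cast_nonneg _))
      (Real.rpow_nonneg (Nat.cast_nonneg _) _)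
  have hmin0 : (0 : ℝ) ≤ s * min (nA + r : ℝ) μ :=
    mul_nonneg (Nat.cast_nonneg _)
      (le_min (add_nonneg (Nat.cast_nonneg _) (Nat.cast_nonneg _)) hμ0)
  have hBC : (0 : ℝ) ≤ nB + nC := add_nonneg (Nat.cast_nonneg _) (Nat.cast_nonneg _)
  set g : ℝ := nB + nC + n + s * min (nA + r : ℝ) μ with hg
  have hng : (n : ℝ) ≤ g := by linarith
  have hg0 : 0 ≤ g := (Nat.cast_nonneg n).trans hng
  have hL := MatEC.one_le_logb_add_two hg0
  rw [MatEC.softBound]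
  set L : ℝ := Real.logb 2 (g + 2) with hLdef
  rcases Nat.eq_zero_or_pos r with hr | hr
  · -- here `s`, and hence `K`, is not bounded in terms of `g`, but sparse multiplication calls
    -- neither of the two routines
    have h1 := hcost .sparse
    rw [MatEC.diffEvalCost_sparse_of_no_rows _ _ _ _ _ _ _ hr] at h1
    have h2 : (P.cost : ℝ) ≤ n * (2 * h) := by exact_mod_cast h1
    have h3 : (2 * h : ℝ) ≤ 12 * L := by
      have := MatEC.natLog_add_two_le hng
      rw [← hh, ← hLdef] at this
      linarith
    have h4 : L ≤ L ^ (kP + 1) := le_self_pow₀ hL (by omega)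
    have h5 : 1 * 12 ≤ c₁ * (12 + c₂) :=
      mul_le_mul hc₁1 (by linarith) (by norm_num) (by linarith)
    calc (P.cost : ℝ) ≤ n * (2 * h) := h2
      _ ≤ g * (12 * L ^ (kP + 1)) :=
        mul_le_mul hng (by linarith) (mul_nonneg zero_le_two (Nat.cast_nonneg _)) hg0
      _ ≤ g * ((c₁ * (12 + c₂)) * L ^ (kP + 1)) :=
        mul_le_mul_of_nonneg_left (mul_le_mul_of_nonneg_right (by linarith) (by linarith)) hg0
      _ = _ := by ring
  have hDg : (D : ℝ) ≤ 4 * g := by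
    have h1 : (s : ℝ) ≤ s * min (nA + r : ℝ) μ := MatEC.le_mul_min_cost hω hr hl s nA
    have h2 : (0 : ℝ) ≤ n := Nat.cast_nonneg _
    rw [hD, Nat.cast_max, max_le_iff]
    push_cast
    constructor <;> linarith
  have hKle := MatEC.rowFactor_le (le_max_right cP 0) kP hng hDg
  rw [← hΛ, ← hh, ← hK, ← hc₁, ← hLdef] at hKle
  have hhK : h + 1 ≤ K := Nat.le_mul_of_pos_left _ (by omega)
  calc (P.cost : ℝ) ≤ (12 + c₂) * K * g :=
        MatEC.le_of_le_diffEvalCost _ _ _ hω (le_max_right cM 0) hmmc hr hl s hhK hcost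
    _ ≤ (12 + c₂) * (c₁ * L ^ (kP + 1)) * g :=
        mul_le_mul_of_nonneg_right (mul_le_mul_of_nonneg_left hKle (by linarith)) hg0
    _ = _ := by ring
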